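/- Let $k$ be a field, $n\ge 0$ and $m\ge 1$ integers, and let $Q=k[x_1,\dots,x_n]$ with $\deg x_i=1$. Let $V^{n,m}=\bigoplus_{j\ge 0}Q_{jm}$ be the $m$th Veronese subring of $Q$, and let $S=S^{n,m}$ be the polynomial ring over $k$ with one variable of degree $m$ for each monomial of degree $m$ in $x_1,\dots,x_n$; $S$ acts on $V^{n,m}$ through the homomorphism of graded $k$-algebras $S\to V^{n,m}$ that sends each variable to the corresponding monomial. For a graded $S$-module $M$ let $t^S_i(M)$ denote the largest degree in which $\operatorname{Tor}^S_i(M,k)$ is nonzero ($-\infty$ if it vanishes, $\infty$ if its degrees are unbounded). (1) The monomials of degree $m$ form a minimal set of homogeneous generators of the $k$-algebra $V^{n,m}$, and there is an $i\ge 0$ such that $$t^S_i(V^{n,m})-im=nm-\left\lceil \tfrac{n}{m}\right\rceil m .$$ (2) Suppose that $k$ contains a primitive $m$th root of unity $w$, let $G$ be a cyclic group of order $m$ with generator $g$, and let $V$ be the $n$-dimensional representation of $G$ with basis $x_1,\dots,x_n$ on which $g x_i=w x_i$, so that $G$ acts on $k[V]=Q$ by algebra automorphisms. Then $|G|$ is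 invertible in $k$ and $Q^G=V^{n,m}$. Let $\tau_G(V)$ be the smallest positive degree $d$ such that the ideal of $Q$ generated by the invariants of positive degree contains $Q_d$. If $n=3$ and $m\ge 3$, or $n\ge 4$ and $m\ne 1$, then $\tau_G(V)=|G|$ and $$t^S_i(V^{n,m})>(i+1)\,\tau_G(V)\quad\text{for some } i\ge 0 .$$ In particular Derksen's conjecture, that in the non-modular case $t^{S'}_i(k[V]^G)\le (i+1)\tau_G(V)\le (i+1)|G|$ for all $i$, where $S'$ is the polynomial ring on a minimal set of homogeneous generators of $k[V]^G$ (each variable having the degree of its generator), fails for this representation. -/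

import Mathlib

open scoped TensorProduct

noncomputable section

universe u

/-! ### Graded modules, graded free resolutions, graded Tor and its end

A `ℤ`-grading of a ring or module is given by its family of homogeneous components. -/

section GradedTor

variable {A M N : Type u} [CommRing A] [AddCommGroup M] [Module A M] [AddCommGroup N] [Module A N]

/-- The end of a graded group: the largest degree in which it is nonzero; it is `⊥ = -∞` for the
zero group and `⊤ = ∞` if the degrees are not bounded above. -/
def gradedEnd {T : Type u} [AddCommGroup T] (𝒯 : ℤ → AddSubgroup T) : EReal :=
  sSup ((fun d : ℤ => ((d : ℝ) : EReal)) '' {d : ℤ | 𝒯 d ≠ ⊥})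

/-- The degree `d` component of a free module over a graded ring with basis `b`, where the basis
element `b j` has degree `deg j`. -/
def gradedFreePiece (𝒜 : ℤ → AddSubgroup A) {F ι : Type u} [AddCommGroup F] [Module A F]
    (b : Module.Basis ι A F) (deg : ι → ℤ) (d : ℤ) : AddSubgroup F where
  carrier := {x | ∀ j, b.repr x j ∈ 𝒜 (d - deg j)}
  add_mem' hx hy j := by simpa using (𝒜 _).add_mem (hx j) (hy j)
  zero_mem' j := by simp
  neg_mem' hx j := by simpa using hx j

/-- The degree `d` component of a tensor product of graded modules. -/
def gradedTensorPiece {F : Type u} [AddCommGroup F] [Module A F]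
    (𝓕 : ℤ → AddSubgroup F) (𝒩 : ℤ → AddSubgroup N) (d : ℤ) : AddSubgroup (F ⊗[A] N) :=
  AddSubgroup.closure {z | ∃ a b : ℤ, a + b = d ∧ ∃ x ∈ 𝓕 a, ∃ y ∈ 𝒩 b, x ⊗ₜ[A] y = z}

/-- A graded free resolution `⋯ → F₁ → F₀ → M → 0` of a graded `A`-module `M`: each `Fᵢ` is free
on a homogeneous basis and all maps preserve degrees. -/
structure GradedFreeResolution (𝒜 : ℤ → AddSubgroup A) (ℳ : ℤ → AddSubgroup M) where
  F : ℕ → Type u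
  [addCommGroup : ∀ i, AddCommGroup (F i)]
  [module : ∀ i, Module A (F i)]
  ι : ℕ → Type u
  basis : ∀ i, Module.Basis (ι i) A (F i)
  deg : ∀ i, ι i → ℤ
  d : ∀ i, F (i + 1) →ₗ[A] F i
  ε : F 0 →ₗ[A] M
  d_mem : ∀ i j, d i (basis (i + 1) j) ∈ gradedFreePiece 𝒜 (basis i) (deg i) (deg (i + 1) j)
  ε_mem : ∀ j, ε (basis 0 j) ∈ ℳ (deg 0 j)
  ε_surjective : Function.Surjective ε
  exact_zero : Function.Exact (d 0) ε
  exact_succ : ∀ i, Function.Exact (d (i + 1)) (d i)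

namespace GradedFreeResolution

attribute [instance] addCommGroup module

variable {𝒜 : ℤ → AddSubgroup A} {ℳ : ℤ → AddSubgroup M}

variable (N) in
/-- The cycles of `F ⊗ N` in homological degree `i`. -/
def cycles (F : GradedFreeResolution 𝒜 ℳ) : ∀ i, Submodule A (F.F i ⊗[A] N)
  | 0 => ⊤
  | i + 1 => LinearMap.ker ((F.d i).rTensor N)

variable (N) in
/-- The boundaries of `F ⊗ N` in homological degree `i`. -/
def boundaries (F : GradedFreeResolution 𝒜 ℳ) (i : ℕ) : Submodule A (F.F i ⊗[A] N) :=
  LinearMap.range ((F.d i).rTensor N)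

variable (N) in
/-- `Tor_i^A(M, N)`, computed as the `i`th homology of `F ⊗ N`. -/
abbrev Tor (F : GradedFreeResolution 𝒜 ℳ) (i : ℕ) : Type u :=
  F.cycles N i ⧸ (F.boundaries N i).comap (F.cycles N i).subtype

/-- The component of degree `d` of `Tor_i^A(M, N)`: the classes of the cycles of degree `d`. -/
def torPiece (F : GradedFreeResolution 𝒜 ℳ) (𝒩 : ℤ → AddSubgroup N) (i : ℕ) (d : ℤ) :
    AddSubgroup (F.Tor N i) :=
  ((gradedTensorPiece (gradedFreePiece 𝒜 (F.basis i) (F.deg i)) 𝒩 d).comap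
    (F.cycles N i).subtype.toAddMonoidHom).map
      ((F.boundaries N i).comap (F.cycles N i).subtype).mkQ.toAddMonoidHom

end GradedFreeResolution

/-- The ideal `A₊` generated by the homogeneous elements of positive degree. -/
def irrelevantIdeal (𝒜 : ℤ → AddSubgroup A) : Ideal A :=
  Ideal.span {a | ∃ d : ℤ, 0 < d ∧ a ∈ 𝒜 d}

/-- The grading of `A / A₊` (which is `k` in degree `0`, when `A` is nonnegatively graded
with `A₀ = k`). -/
def residuePiece (𝒜 : ℤ → AddSubgroup A) (d : ℤ) : AddSubgroup (A ⧸ irrelevantIdeal 𝒜) :=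
  (𝒜 d).map (Ideal.Quotient.mk (irrelevantIdeal 𝒜)).toAddMonoidHom

/-- `t_i^A(M)`, the end of `Tor_i^A(M, k)` with `k = A / A₊`. Any two graded free resolutions of
`M` give isomorphic graded groups `Tor_i^A(M, k)`, so that the supremum is over a family with
only one value. -/
def torEnd (𝒜 : ℤ → AddSubgroup A) (ℳ : ℤ → AddSubgroup M) (i : ℕ) : EReal :=
  ⨆ F : GradedFreeResolution 𝒜 ℳ, gradedEnd (F.torPiece (residuePiece 𝒜) i)

end GradedTor

/-! ### Graded subalgebras of a polynomial ring -/

section Subalgebras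

variable {k : Type u} [Field k] {n : ℕ}

/-- The component of degree `d` of a graded subalgebra `R` of `k[x₁, …, xₙ]`, `deg xᵢ = 1`. -/
def subalgebraPiece (R : Subalgebra k (MvPolynomial (Fin n) k)) (d : ℤ) : AddSubgroup R :=
  ((MvPolynomial.weightedHomogeneousSubmodule k (fun _ : Fin n => (1 : ℤ)) d).comap
    R.val.toLinearMap).toAddSubgroup

/-- `f` is a minimal family of homogeneous generators of the algebra `R`, and `f j` has
degree `e j`. -/
structure IsMinimalGenerators (R : Subalgebra k (MvPolynomial (Fin n) k)) {σ : Type}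
    (f : σ → R) (e : σ → ℕ) : Prop where
  pos : ∀ j, 0 < e j
  homogeneous : ∀ j, (f j : MvPolynomial (Fin n) k).IsHomogeneous (e j)
  generate : Algebra.adjoin k (Set.range f) = ⊤
  minimal : ∀ s : Set σ, Algebra.adjoin k (f '' s) = ⊤ → s = Set.univ

/-- `t_i^S(R)`, where `S = k[X_j : j ∈ σ]` is graded by `deg X_j = e j` and acts on `R` through
the algebra homomorphism `X_j ↦ f j`. -/
def syzygyEnd (R : Subalgebra k (MvPolynomial (Fin n) k)) {σ : Type} (f : σ → R) (e : σ → ℕ)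
    (i : ℕ) : EReal :=
  letI : Module (MvPolynomial σ k) R :=
    Module.compHom R (MvPolynomial.aeval f : MvPolynomial σ k →ₐ[k] R).toRingHom
  torEnd
    (fun d => (MvPolynomial.weightedHomogeneousSubmodule k (fun j : σ => (e j : ℤ)) d).toAddSubgroup)
    (subalgebraPiece R) i

end Subalgebras

/-! ### Rings of invariants and Derksen's inequalities -/

section Invariants

variable {k : Type u} [Field k] {n : ℕ} {G : Type*} [Group G]

/-- The automorphism of `k[V] = k[x₁, …, xₙ]` induced by `g`, where the variables `x_j` are
identified with the standard basis of the representation `V = kⁿ`. -/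
def polyAction (ρ : Representation k G (Fin n → k)) (g : G) :
    MvPolynomial (Fin n) k →ₐ[k] MvPolynomial (Fin n) k :=
  MvPolynomial.aeval fun j => ∑ i, ρ g (Pi.single j 1) i • MvPolynomial.X i

/-- The ring of invariants `k[V]^G`. -/
def polyInvariants (ρ : Representation k G (Fin n → k)) :
    Subalgebra k (MvPolynomial (Fin n) k) :=
  ⨅ g : G, AlgHom.equalizer (polyAction ρ g) (AlgHom.id k _)

/-- The ideal of `k[V]` generated by the invariants of positive degree. -/
def hilbertIdeal (ρ : Representation k G (Fin n → k)) : Ideal (MvPolynomial (Fin n) k) :=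
  Ideal.span {p | p ∈ polyInvariants ρ ∧ ∃ d : ℕ, 0 < d ∧ p.IsHomogeneous d}

/-- `τ_G(V)`: the smallest positive degree `d` in which the Hilbert ideal contains every form. -/
def tauG (ρ : Representation k G (Fin n → k)) : ℕ :=
  sInf {d : ℕ | 0 < d ∧ ∀ p : MvPolynomial (Fin n) k, p.IsHomogeneous d → p ∈ hilbertIdeal ρ}

/-- The assertion of Derksen's conjecture for the representation `ρ`:
`t_i^S(R) ≤ (i + 1) τ_G(V) ≤ (i + 1) |G|` for all `i`, where `R = k[V]^G` and `S` is the
polynomial ring on a minimal set of generators of `R`. -/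
def DerksenInequalities (ρ : Representation k G (Fin n → k)) : Prop :=
  ∀ (σ : Type) [Finite σ] (f : σ → polyInvariants ρ) (e : σ → ℕ),
    IsMinimalGenerators (polyInvariants ρ) f e → ∀ i : ℕ,
      syzygyEnd (polyInvariants ρ) f e i ≤ (((i + 1) * tauG ρ : ℕ) : EReal) ∧
        (i + 1) * tauG ρ ≤ (i + 1) * Nat.card G

end Invariants

/-! ### Veronese subrings -/

section Veronese

variable (k : Type u) [Field k] (n m : ℕ)

/-- The Veronese subring `V^{n,m} = ⨁_i k[x₁, …, xₙ]_{im}`. -/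
def veronese : Subalgebra k (MvPolynomial (Fin n) k) :=
  Submodule.toSubalgebra (⨆ i : ℕ, MvPolynomial.homogeneousSubmodule (Fin n) k (i * m))
    (Submodule.mem_iSup_of_mem 0 (by
      rw [zero_mul]
      exact MvPolynomial.isHomogeneous_one (Fin n) k))
    (fun p q hp hq => by
      induction hp using Submodule.iSup_induction' with
      | zero => simp
      | add x y _ _ hx hy => rw [add_mul]; exact Submodule.add_mem _ hx hy
      | mem i x hx =>
        induction hq using Submodule.iSup_induction' with
        | zero => simp
        | add y z _ _ hy hz => rw [mul_add]; exact Submodule.add_mem _ hy hz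
        | mem j y hy =>
          refine Submodule.mem_iSup_of_mem (i + j) ?_
          rw [add_mul]
          exact MvPolynomial.IsHomogeneous.mul hx hy)

/-- The exponents of the monomials of degree `m` in `n` variables. -/
abbrev VeroneseIndex : Type := {s : Fin n →₀ ℕ // s.degree = m}

/-- The monomials of degree `m`; they form the standard basis of `k[x₁, …, xₙ]_m`, so that
`S^{n,m}` is the polynomial ring on variables indexed by them. -/
def veroneseGen (s : VeroneseIndex n m) : veronese k n m :=
  ⟨MvPolynomial.monomial s.1 1, Submodule.mem_iSup_of_mem 1 (by
    rw [one_mul]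
    exact MvPolynomial.isHomogeneous_monomial 1 s.2)⟩

/-- `t_i^{S^{n,m}}(V^{n,m})`. -/
def veroneseSyzygyEnd (i : ℕ) : EReal :=
  syzygyEnd (veronese k n m) (veroneseGen k n m) (fun _ => m) i

end Veronese

end

/-! The Veronese ring is Cohen–Macaulay for an elementary reason: modulo any set of the powers `x_i
^ m`, it has a basis of monomials (`mem_varIdeal_smul_veronese_iff`), so these powers form a regular
sequence in any order. Modulo all of them the surviving monomials have every exponent at most `m -
1` and degree divisible by `m`. The top degree is therefore `D = ⌊n(m-1)/m⌋ m = nm - ⌈n/m⌉ m`.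

Let `T` be the variables of `S` that map to the `x_i ^ m`, and `c` the number of other variables.
The homology of a resolution modulo a set `s` of variables is `Tor(M, S/(s))`. Where this vanishes
in degree `i + 1`, adjoining a variable `a` identifies the new homology in degree `i + 1` with the
kernel of `a` on the old homology in degree `i`, shifted by `deg a`. With regularity this kills
higher homology modulo `T` (`cyclesMod_insert_le`). Adjoining the other `c` variables one by one
then carries the top degree of `M/TM`, which consists of socle elements, up to `Tor_c(M, k)`
(`exists_lift`), and every class there descends to `M/TM` (`exists_descent`). Hence `t_c = D + cm`
(`torEnd_eq_of_regular`, `veroneseSyzygyEnd_eq`).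

For the scalar action of a cyclic group of order `m`, the invariants are the Veronese ring and `τ =
m` once `n > 0`. So Derksen's bound fails at `i = c` as soon as `D ≥ 2m`, which the numerical
hypotheses ensure. -/

noncomputable section

universe u

open MvPolynomial

/-! ### Modules modulo a set of variables -/

section VariableIdeals

variable {σ : Type*} {k : Type u} [Field k]

variable (k) in
/-- The ideal generated by a set of variables. -/
abbrev varIdeal (s : Set σ) : Ideal (MvPolynomial σ k) := Ideal.span (X '' s)

variable {N : Type*} [AddCommGroup N] [Module (MvPolynomial σ k) N]

theorem mem_varIdeal_insert_smul_top {a : σ} {s : Set σ} {x : N} :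
    x ∈ varIdeal k (insert a s) • (⊤ : Submodule (MvPolynomial σ k) N) ↔
      ∃ z, ∃ y ∈ varIdeal k s • (⊤ : Submodule (MvPolynomial σ k) N),
        x = (X a : MvPolynomial σ k) • z + y := by
  rw [varIdeal, Set.image_insert_eq, Ideal.span_insert, Submodule.sup_smul, Submodule.mem_sup]
  constructor
  · rintro ⟨x₁, h₁, x₂, h₂, rfl⟩
    rw [Submodule.ideal_span_singleton_smul] at h₁
    obtain ⟨z, -, rfl⟩ := Submodule.mem_smul_pointwise_iff_exists _ _ _ |>.1 h₁
    exact ⟨z, x₂, h₂, rfl⟩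
  · rintro ⟨z, y, hy, rfl⟩
    exact ⟨_, Submodule.smul_mem_smul (Ideal.mem_span_singleton_self _) trivial, y, hy, rfl⟩

theorem X_smul_mem_varIdeal_insert_smul_top (a : σ) (s : Set σ) (z : N) :
    (X a : MvPolynomial σ k) • z ∈
      varIdeal k (insert a s) • (⊤ : Submodule (MvPolynomial σ k) N) :=
  mem_varIdeal_insert_smul_top.2 ⟨z, 0, zero_mem _, by simp⟩

theorem varIdeal_smul_top_le_insert (a : σ) (s : Set σ) :
    varIdeal k s • (⊤ : Submodule (MvPolynomial σ k) N) ≤ varIdeal k (insert a s) • ⊤ :=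
  Submodule.smul_mono_left (Ideal.span_mono (Set.image_mono (Set.subset_insert _ _)))

theorem LinearMap.map_mem_ideal_smul_top {A : Type*} [CommRing A] {N N' : Type*} [AddCommGroup N]
    [Module A N] [AddCommGroup N'] [Module A N'] (f : N →ₗ[A] N') {I : Ideal A} {x : N}
    (hx : x ∈ I • (⊤ : Submodule A N)) : f x ∈ I • (⊤ : Submodule A N') :=
  Submodule.smul_top_le_comap_smul_top I f hx

theorem Module.Basis.mem_ideal_smul_top_iff {A : Type*} [CommRing A] {N ι : Type*} [AddCommGroup N]
    [Module A N] (b : Module.Basis ι A N) {I : Ideal A} {x : N} :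
    x ∈ I • (⊤ : Submodule A N) ↔ ∀ j, b.repr x j ∈ I := by
  constructor
  · intro hx j
    simpa using (b.coord j).map_mem_ideal_smul_top hx
  · intro h
    rw [← b.linearCombination_repr x, Finsupp.linearCombination_apply]
    exact Submodule.sum_mem _ fun j _ => Submodule.smul_mem_smul (h j) trivial

/-- The ideal is monomial, and multiplying a monomial by `X a` does not change which variables of
`s` divide it. -/
theorem mem_varIdeal_of_X_mul_mem {a : σ} {s : Set σ} (ha : a ∉ s) {p : MvPolynomial σ k}
    (h : X a * p ∈ varIdeal k s) : p ∈ varIdeal k s := by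
  classical
  rw [varIdeal, mem_ideal_span_X_image] at h ⊢
  intro t ht
  obtain ⟨i, his, hi⟩ := h (Finsupp.single a 1 + t) (by
    rw [mem_support_iff, coeff_X_mul]; exact mem_support_iff.1 ht)
  refine ⟨i, his, ?_⟩
  have : a ≠ i := fun h => ha (h ▸ his)
  simpa [Finsupp.single_apply, this] using hi

theorem Module.Basis.mem_varIdeal_smul_top_of_X_smul_mem {ι : Type*}
    (b : Module.Basis ι (MvPolynomial σ k) N) {a : σ} {s : Set σ} (ha : a ∉ s) {x : N}
    (h : (X a : MvPolynomial σ k) • x ∈ varIdeal k s • (⊤ : Submodule (MvPolynomial σ k) N)) :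
    x ∈ varIdeal k s • (⊤ : Submodule (MvPolynomial σ k) N) := by
  rw [b.mem_ideal_smul_top_iff] at h ⊢
  intro j
  exact mem_varIdeal_of_X_mul_mem ha (by simpa using h j)

end VariableIdeals

/-! ### Homogeneous components of graded free modules -/

section Projections

variable {σ : Type} {k : Type u} [Field k]

variable (k) in
/-- The grading of a polynomial ring in which the variable `X_j` has degree `w j`. -/
abbrev polyPiece (w : σ → ℤ) (d : ℤ) : AddSubgroup (MvPolynomial σ k) :=
  (weightedHomogeneousSubmodule k w d).toAddSubgroup

variable {F ι : Type u} [AddCommGroup F] [Module (MvPolynomial σ k) F]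
  (w : σ → ℤ) (b : Module.Basis ι (MvPolynomial σ k) F) (deg : ι → ℤ)

/-- The projection of a graded free module onto its component of degree `e`. -/
def freeProj (e : ℤ) : F →+ F :=
  (Finsupp.liftAddHom fun j =>
    (LinearMap.toSpanSingleton (MvPolynomial σ k) F (b j)).toAddMonoidHom.comp
      (weightedHomogeneousComponent w (e - deg j)).toAddMonoidHom).comp
    b.repr.toLinearMap.toAddMonoidHom

theorem freeProj_smul_basis (e : ℤ) (p : MvPolynomial σ k) (j : ι) :
    freeProj w b deg e (p • b j) = weightedHomogeneousComponent w (e - deg j) p • b j := by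
  simp [freeProj]

/-- Projections onto components are additive but not linear over the polynomial ring, so maps are
compared on monomial multiples of basis elements. -/
theorem Module.Basis.addMonoidHom_ext {N' : Type*} [AddCommGroup N'] {f g : F →+ N'}
    (h : ∀ j (t : σ →₀ ℕ) (c : k), f (monomial t c • b j) = g (monomial t c • b j)) : f = g := by
  have key : f.comp b.repr.symm.toLinearMap.toAddMonoidHom =
      g.comp b.repr.symm.toLinearMap.toAddMonoidHom := by
    refine Finsupp.addHom_ext fun j p => ?_
    simp only [AddMonoidHom.comp_apply, LinearMap.toAddMonoidHom_coe, LinearEquiv.coe_coe,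
      Module.Basis.repr_symm_single]
    induction p using MvPolynomial.induction_on' with
    | monomial t c => exact h j t c
    | add p q hp hq => rw [add_smul, map_add, map_add, hp, hq]
  ext x
  simpa using DFunLike.congr_fun key (b.repr x)

theorem repr_freeProj (e : ℤ) (x : F) (j : ι) :
    b.repr (freeProj w b deg e x) j = weightedHomogeneousComponent w (e - deg j) (b.repr x j) := by
  classical
  have : ((Finsupp.applyAddHom j).comp b.repr.toLinearMap.toAddMonoidHom).comp
      (freeProj w b deg e) =
      (weightedHomogeneousComponent w (e - deg j)).toAddMonoidHom.comp
      ((Finsupp.applyAddHom j).comp b.repr.toLinearMap.toAddMonoidHom) := by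
    refine b.addMonoidHom_ext fun i t c => ?_
    by_cases h : i = j
    · subst h; simp [freeProj_smul_basis]
    · simp [freeProj_smul_basis, h]
  simpa using DFunLike.congr_fun this x

theorem freeProj_mem (e : ℤ) (x : F) :
    freeProj w b deg e x ∈ gradedFreePiece (polyPiece k w) b deg e := fun j => by
  rw [repr_freeProj]
  exact weightedHomogeneousComponent_mem _ _ _

variable {w b deg} in
theorem freeProj_of_mem {d : ℤ} {x : F} (hx : x ∈ gradedFreePiece (polyPiece k w) b deg d)
    (e : ℤ) : freeProj w b deg e x = if e = d then x else 0 := by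
  apply b.ext_elem
  intro j
  rw [repr_freeProj, weightedHomogeneousComponent_of_mem (hx j)]
  by_cases h : e = d <;> simp [h]

theorem freeProj_X_smul (e : ℤ) (a : σ) (x : F) :
    freeProj w b deg (e + w a) ((X a : MvPolynomial σ k) • x) =
      (X a : MvPolynomial σ k) • freeProj w b deg e x := by
  classical
  apply b.ext_elem
  intro j
  rw [repr_freeProj, map_smul, map_smul, Finsupp.smul_apply, Finsupp.smul_apply, repr_freeProj]
  ext t
  simp only [smul_eq_mul, coeff_weightedHomogeneousComponent, coeff_X_mul', Finsupp.mem_support_iff]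
  by_cases ht : t a = 0
  · simp [ht]
  · have : Finsupp.weight w t = Finsupp.weight w (t - Finsupp.single a 1) + w a := by
      conv_lhs => rw [← Finsupp.sub_add_single_one_cancel ht]
      rw [map_add, Finsupp.weight_single, one_smul]
    simp only [ne_eq, ht, not_false_eq_true, if_true, this]
    congr 1
    rw [eq_iff_iff]; constructor <;> intro h <;> linarith

-- An ideal generated by variables is monomial, and taking a component only discards monomials.
variable {w b deg} in
theorem freeProj_mem_varIdeal_smul_top (e : ℤ) {s : Set σ} {x : F}
    (hx : x ∈ varIdeal k s • (⊤ : Submodule (MvPolynomial σ k) F)) :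
    freeProj w b deg e x ∈ varIdeal k s • (⊤ : Submodule (MvPolynomial σ k) F) := by
  classical
  rw [b.mem_ideal_smul_top_iff] at hx ⊢
  intro j
  have := hx j
  rw [varIdeal, mem_ideal_span_X_image] at this ⊢
  rw [repr_freeProj, support_weightedHomogeneousComponent]
  exact fun t ht => this t (Finset.mem_filter.1 ht).1

variable {w b deg} in
/-- A degree-preserving map commutes with the projections onto the components. -/
theorem map_freeProj {N : Type*} [AddCommGroup N] [Module (MvPolynomial σ k) N]
    {𝒩 : ℤ → AddSubgroup N} {π : ℤ → N →+ N}
    (hπ : ∀ d, ∀ v ∈ 𝒩 d, ∀ e, π e v = if e = d then v else 0)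
    (hmul : ∀ d e, ∀ p ∈ polyPiece k w d, ∀ v ∈ 𝒩 e, p • v ∈ 𝒩 (d + e))
    (f : F →ₗ[MvPolynomial σ k] N) (hf : ∀ j, f (b j) ∈ 𝒩 (deg j)) (e : ℤ) (x : F) :
    f (freeProj w b deg e x) = π e (f x) := by
  have : f.toAddMonoidHom.comp (freeProj w b deg e) = (π e).comp f.toAddMonoidHom := by
    refine b.addMonoidHom_ext fun j t c => ?_
    have ht : (monomial t c : MvPolynomial σ k) ∈ polyPiece k w (Finsupp.weight w t) :=
      isWeightedHomogeneous_monomial w t c rfl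
    have h := hπ _ _ (hmul _ _ _ ht _ (hf j)) e
    simp only [AddMonoidHom.comp_apply, LinearMap.toAddMonoidHom_coe, freeProj_smul_basis, map_smul,
      h, weightedHomogeneousComponent_of_mem ht]
    by_cases he : e = Finsupp.weight w t + deg j
    · simp [he]
    · rw [if_neg he, if_neg (fun h => he (by linarith)), zero_smul]
  exact DFunLike.congr_fun this x

theorem smul_mem_gradedFreePiece {d e : ℤ} {p : MvPolynomial σ k} (hp : p ∈ polyPiece k w d)
    {x : F} (hx : x ∈ gradedFreePiece (polyPiece k w) b deg e) :
    p • x ∈ gradedFreePiece (polyPiece k w) b deg (d + e) := fun j => by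
  rw [map_smul, Finsupp.smul_apply, smul_eq_mul, add_sub_assoc]
  exact IsWeightedHomogeneous.mul hp (hx j)

variable {w b deg} in
theorem map_freeProj_free {F' ι' : Type u} [AddCommGroup F'] [Module (MvPolynomial σ k) F']
    {b' : Module.Basis ι' (MvPolynomial σ k) F'} {deg' : ι' → ℤ}
    (f : F →ₗ[MvPolynomial σ k] F')
    (hf : ∀ j, f (b j) ∈ gradedFreePiece (polyPiece k w) b' deg' (deg j)) (e : ℤ) (x : F) :
    f (freeProj w b deg e x) = freeProj w b' deg' e (f x) :=
  map_freeProj (𝒩 := gradedFreePiece (polyPiece k w) b' deg') (π := freeProj w b' deg')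
    (fun _ _ hv e => freeProj_of_mem hv e)
    (fun _ _ _ hp _ hv => smul_mem_gradedFreePiece w b' deg' hp hv) f hf e x

end Projections

/-! ### Homology of a resolution modulo a set of variables -/

namespace GradedFreeResolution

variable {σ : Type} {k : Type u} [Field k] {w : σ → ℤ} {M : Type u} [AddCommGroup M]
  [Module (MvPolynomial σ k) M] {ℳ : ℤ → AddSubgroup M}
  (F : GradedFreeResolution (polyPiece k w) ℳ)

/-- The elements of `Fᵢ` that are cycles modulo the variables in `s`. -/
def cyclesMod (s : Set σ) : ∀ i, Submodule (MvPolynomial σ k) (F.F i)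
  | 0 => ⊤
  | i + 1 => (varIdeal k s • ⊤ : Submodule (MvPolynomial σ k) (F.F i)).comap (F.d i)

/-- The elements of `Fᵢ` that are boundaries modulo the variables in `s`. -/
def boundariesMod (s : Set σ) (i : ℕ) : Submodule (MvPolynomial σ k) (F.F i) :=
  LinearMap.range (F.d i) ⊔ varIdeal k s • ⊤

/-- The projection of `Fᵢ` onto its component of degree `e`. -/
abbrev proj (i : ℕ) (e : ℤ) : F.F i →+ F.F i := freeProj w (F.basis i) (F.deg i) e

variable {F}

theorem mem_boundariesMod {s : Set σ} {i : ℕ} {x : F.F i} :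
    x ∈ F.boundariesMod s i ↔ ∃ y, ∃ r ∈ varIdeal k s • (⊤ : Submodule (MvPolynomial σ k) (F.F i)),
      x = F.d i y + r := by
  rw [boundariesMod, Submodule.mem_sup]
  constructor
  · rintro ⟨_, ⟨y, rfl⟩, r, hr, rfl⟩
    exact ⟨y, r, hr, rfl⟩
  · rintro ⟨y, r, hr, rfl⟩
    exact ⟨_, ⟨y, rfl⟩, r, hr, rfl⟩

theorem boundariesMod_le_insert (a : σ) (s : Set σ) (i : ℕ) :
    F.boundariesMod s i ≤ F.boundariesMod (insert a s) i :=
  sup_le_sup_left (varIdeal_smul_top_le_insert a s) _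

theorem X_smul_mem_boundariesMod_insert (a : σ) (s : Set σ) {i : ℕ} (x : F.F i) :
    (X a : MvPolynomial σ k) • x ∈ F.boundariesMod (insert a s) i :=
  (le_sup_right : _ ≤ F.boundariesMod (insert a s) i) (X_smul_mem_varIdeal_insert_smul_top a s x)

theorem d_d (i : ℕ) (x : F.F (i + 2)) : F.d i (F.d (i + 1) x) = 0 :=
  (F.exact_succ i _).2 ⟨x, rfl⟩

theorem d_proj (i : ℕ) (e : ℤ) (x : F.F (i + 1)) :
    F.d i (F.proj (i + 1) e x) = F.proj i e (F.d i x) :=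
  map_freeProj_free (F.d i) (F.d_mem i) e x

/-- An element whose multiple by a new variable is, modulo the variables in `s`, a boundary, is
a cycle modulo `s`. -/
theorem mem_cyclesMod_of_d_eq {a : σ} {s : Set σ} (ha : a ∉ s) {i : ℕ} {x : F.F (i + 1)}
    {z r : F.F i} (hr : r ∈ varIdeal k s • (⊤ : Submodule (MvPolynomial σ k) (F.F i)))
    (h : F.d i x = (X a : MvPolynomial σ k) • z + r) : z ∈ F.cyclesMod s i := by
  cases i with
  | zero => trivial
  | succ i =>
    refine (F.basis i).mem_varIdeal_smul_top_of_X_smul_mem ha ?_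
    -- Applying `d` once more gives `0 = X a • d z + d r`, and `X a` is regular on a free module
    -- modulo `s`.
    have h' := congrArg (F.d i) h
    rw [d_d, map_add, map_smul] at h'
    rw [eq_neg_of_add_eq_zero_left h'.symm]
    exact neg_mem ((F.d i).map_mem_ideal_smul_top hr)

/-- If homology modulo `s` vanishes in degree `i + 1` and the variable `a` is regular on homology
in degree `i`, then homology modulo `s ∪ {a}` vanishes in degree `i + 1`. -/
theorem cyclesMod_insert_le {a : σ} {s : Set σ} (ha : a ∉ s) {i : ℕ}
    (hv : F.cyclesMod s (i + 1) ≤ F.boundariesMod s (i + 1))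
    (hreg : ∀ z ∈ F.cyclesMod s i,
      (X a : MvPolynomial σ k) • z ∈ F.boundariesMod s i → z ∈ F.boundariesMod s i) :
    F.cyclesMod (insert a s) (i + 1) ≤ F.boundariesMod (insert a s) (i + 1) := by
  intro x hx
  obtain ⟨z, r, hr, h⟩ := mem_varIdeal_insert_smul_top.1 (show F.d i x ∈ _ from hx)
  obtain ⟨y, r', hr', rfl⟩ := mem_boundariesMod.1 <| hreg z (mem_cyclesMod_of_d_eq ha hr h)
    (mem_boundariesMod.2 ⟨x, -r, neg_mem hr, by rw [h]; abel⟩)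
  -- With `X a • z` replaced by its value, this difference is a cycle modulo `s`, hence a boundary;
  -- the correction `X a • y` vanishes modulo `a`.
  have : x - (X a : MvPolynomial σ k) • y ∈ F.cyclesMod s (i + 1) := by
    change F.d i _ ∈ varIdeal k s • (⊤ : Submodule (MvPolynomial σ k) (F.F i))
    rw [map_sub, map_smul, h, smul_add]
    rw [add_assoc, add_sub_cancel_left]
    exact add_mem (Submodule.smul_mem _ _ hr') hr
  have := add_mem (boundariesMod_le_insert a s _ (hv this)) (X_smul_mem_boundariesMod_insert a s y)
  simpa using this

/-- Passing to a higher homology class along a variable that kills a homogeneous class. -/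
theorem exists_lift {a : σ} {s : Set σ} (ha : a ∉ s) {i : ℕ} {e : ℤ} {z : F.F i}
    (hv : F.cyclesMod s (i + 1) ≤ F.boundariesMod s (i + 1))
    (hz : F.proj i e z = z) (hb : z ∉ F.boundariesMod s i)
    (hann : ∀ c, (X c : MvPolynomial σ k) • z ∈ F.boundariesMod s i) :
    ∃ x ∈ F.cyclesMod (insert a s) (i + 1), F.proj (i + 1) (e + w a) x = x ∧
      x ∉ F.boundariesMod (insert a s) (i + 1) ∧
      ∀ c, (X c : MvPolynomial σ k) • x ∈ F.boundariesMod (insert a s) (i + 1) := by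
  obtain ⟨x₀, r₀, hr₀, h₀⟩ := mem_boundariesMod.1 (hann a)
  -- Projecting the relation to degree `e + w a` makes the lifted class homogeneous.
  obtain ⟨r, hr, h⟩ : ∃ r ∈ varIdeal k s • (⊤ : Submodule (MvPolynomial σ k) (F.F i)),
      (X a : MvPolynomial σ k) • z = F.d i (F.proj (i + 1) (e + w a) x₀) + r := by
    refine ⟨_, freeProj_mem_varIdeal_smul_top (w := w) (b := F.basis i) (deg := F.deg i)
      (e + w a) hr₀, ?_⟩
    conv_lhs => rw [← hz, ← freeProj_X_smul, h₀, map_add]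
    rw [d_proj]
  have hx : F.proj (i + 1) (e + w a) (F.proj (i + 1) (e + w a) x₀) =
      F.proj (i + 1) (e + w a) x₀ := by
    rw [proj, freeProj_of_mem (freeProj_mem _ _ _ _ _), if_pos rfl]
  generalize F.proj (i + 1) (e + w a) x₀ = x at h hx
  have h' : F.d i x = (X a : MvPolynomial σ k) • z + -r := by rw [h]; abel
  refine ⟨x, mem_varIdeal_insert_smul_top.2 ⟨z, -r, neg_mem hr, h'⟩, hx, ?_, ?_⟩
  · intro hx'
    obtain ⟨y, t, ht, rfl⟩ := mem_boundariesMod.1 hx'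
    obtain ⟨u, t', ht', rfl⟩ := mem_varIdeal_insert_smul_top.1 ht
    apply hb
    rw [map_add, d_d, zero_add, map_add, map_smul] at h'
    -- If `x` were a boundary modulo `insert a s`, then `X a • (z - d u)` would lie in `s F`;
    -- cancelling `X a` would make `z` a boundary modulo `s`.
    have : z - F.d i u ∈ varIdeal k s • (⊤ : Submodule (MvPolynomial σ k) (F.F i)) := by
      refine (F.basis i).mem_varIdeal_smul_top_of_X_smul_mem ha ?_
      have e : (X a : MvPolynomial σ k) • (z - F.d i u) = F.d i t' + r := by
        rw [smul_sub, sub_eq_iff_eq_add, ← sub_eq_zero]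
        rw [← sub_eq_zero] at h'
        rw [← neg_eq_zero, ← h']
        abel
      rw [e]
      exact add_mem ((F.d i).map_mem_ideal_smul_top ht') hr
    exact mem_boundariesMod.2 ⟨u, _, this, by abel⟩
  · intro c
    obtain ⟨x', r', hr', hc⟩ := mem_boundariesMod.1 (hann c)
    -- The relations for `X a • z` and `X c • z` combine into a cycle modulo `s`, hence a boundary.
    -- As `X a • x'` vanishes modulo `a`, the new class is again killed by every variable, so the
    -- lifting can be repeated.
    have : (X c : MvPolynomial σ k) • x - (X a : MvPolynomial σ k) • x' ∈
        F.cyclesMod s (i + 1) := by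
      change F.d i _ ∈ varIdeal k s • (⊤ : Submodule (MvPolynomial σ k) (F.F i))
      have e : F.d i ((X c : MvPolynomial σ k) • x - (X a : MvPolynomial σ k) • x') =
          (X a : MvPolynomial σ k) • r' - (X c : MvPolynomial σ k) • r := by
        have hc' : F.d i x' = (X c : MvPolynomial σ k) • z - r' := by rw [hc]; abel
        rw [map_sub, map_smul, map_smul, h', hc', smul_add, smul_sub, smul_neg,
          smul_comm (X c : MvPolynomial σ k) (X a : MvPolynomial σ k) z]
        abel
      rw [e]
      exact sub_mem (Submodule.smul_mem _ _ hr') (Submodule.smul_mem _ _ hr)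
    have := add_mem (boundariesMod_le_insert a s _ (hv this))
      (X_smul_mem_boundariesMod_insert a s x')
    simpa using this

/-- Passing to a lower homology class along a variable. -/
theorem exists_descent {a : σ} {s : Set σ} (ha : a ∉ s) {i : ℕ} {e : ℤ} {x : F.F (i + 1)}
    (hv : F.cyclesMod s (i + 1) ≤ F.boundariesMod s (i + 1))
    (hx : x ∈ F.cyclesMod (insert a s) (i + 1)) (he : F.proj (i + 1) (e + w a) x = x)
    (hb : x ∉ F.boundariesMod (insert a s) (i + 1)) :
    ∃ z ∈ F.cyclesMod s i, F.proj i e z = z ∧ z ∉ F.boundariesMod s i := by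
  obtain ⟨z₀, r₀, hr₀, h₀⟩ := mem_varIdeal_insert_smul_top.1 (show F.d i x ∈ _ from hx)
  obtain ⟨r, hr, h⟩ : ∃ r ∈ varIdeal k s • (⊤ : Submodule (MvPolynomial σ k) (F.F i)),
      F.d i x = (X a : MvPolynomial σ k) • F.proj i e z₀ + r := by
    refine ⟨_, freeProj_mem_varIdeal_smul_top (w := w) (b := F.basis i) (deg := F.deg i)
      (e + w a) hr₀, ?_⟩
    conv_lhs => rw [← he, d_proj, h₀, map_add, freeProj_X_smul]
  have hz : F.proj i e (F.proj i e z₀) = F.proj i e z₀ := by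
    rw [proj, freeProj_of_mem (freeProj_mem _ _ _ _ _), if_pos rfl]
  generalize F.proj i e z₀ = z at h hz
  refine ⟨z, mem_cyclesMod_of_d_eq ha hr h, hz, fun hz' => hb ?_⟩
  obtain ⟨y, r', hr', rfl⟩ := mem_boundariesMod.1 hz'
  have : x - (X a : MvPolynomial σ k) • y ∈ F.cyclesMod s (i + 1) := by
    change F.d i _ ∈ varIdeal k s • (⊤ : Submodule (MvPolynomial σ k) (F.F i))
    rw [map_sub, map_smul, h, smul_add]
    rw [add_assoc, add_sub_cancel_left]
    exact add_mem (Submodule.smul_mem _ _ hr') hr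
  have := add_mem (boundariesMod_le_insert a s _ (hv this)) (X_smul_mem_boundariesMod_insert a s y)
  simpa using this

/-- Identifies homology in degree zero with `M / s M`, through `ε`. -/
theorem mem_boundariesMod_zero {s : Set σ} {z : F.F 0} :
    z ∈ F.boundariesMod s 0 ↔ F.ε z ∈ varIdeal k s • (⊤ : Submodule (MvPolynomial σ k) M) := by
  constructor
  · intro h
    obtain ⟨y, r, hr, rfl⟩ := mem_boundariesMod.1 h
    rw [map_add, (F.exact_zero _).2 ⟨y, rfl⟩, zero_add]
    exact F.ε.map_mem_ideal_smul_top hr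
  · intro h
    have : (varIdeal k s • ⊤ : Submodule (MvPolynomial σ k) (F.F 0)).map F.ε =
        varIdeal k s • ⊤ := by
      rw [Submodule.map_smul'', Submodule.map_top, LinearMap.range_eq_top.2 F.ε_surjective]
    rw [← this] at h
    obtain ⟨r, hr, h⟩ := h
    obtain ⟨y, hy⟩ := (F.exact_zero (z - r)).1 (by rw [map_sub, h, sub_self])
    exact mem_boundariesMod.2 ⟨y, r, hr, by rw [hy]; abel⟩

/-- If the variables in `T` form a regular sequence on `M` in any order, the homology modulo `T`
vanishes in positive degrees. -/
theorem cyclesMod_le_of_regular (T : Finset σ)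
    (hreg : ∀ s ⊆ T, ∀ a ∈ T, a ∉ s → ∀ v : M,
      (X a : MvPolynomial σ k) • v ∈ varIdeal k (s : Set σ) • (⊤ : Submodule (MvPolynomial σ k) M) →
        v ∈ varIdeal k (s : Set σ) • (⊤ : Submodule (MvPolynomial σ k) M)) :
    ∀ i, F.cyclesMod T (i + 1) ≤ F.boundariesMod T (i + 1) := by
  classical
  suffices ∀ s ⊆ T, ∀ i, F.cyclesMod s (i + 1) ≤ F.boundariesMod s (i + 1) from
    this T subset_rfl
  intro s
  induction s using Finset.induction_on with
  | empty =>
    intro _ i x hx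
    have hx' : F.d i x = 0 := by
      have : F.d i x ∈ varIdeal k (∅ : Set σ) • (⊤ : Submodule (MvPolynomial σ k) (F.F i)) := by
        rw [Finset.coe_empty] at hx
        exact hx
      simpa [varIdeal] using this
    obtain ⟨y, rfl⟩ := (F.exact_succ i x).1 hx'
    exact mem_boundariesMod.2 ⟨y, 0, zero_mem _, by simp⟩
  | insert a s ha ih =>
    intro hs i
    have hs' : s ⊆ T := (Finset.subset_insert a s).trans hs
    have haT : a ∈ T := hs (Finset.mem_insert_self a s)
    rw [Finset.coe_insert]
    refine cyclesMod_insert_le (by simpa using ha) (ih hs' i) fun z hz hz' => ?_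
    -- In degree zero regularity is the hypothesis on `M`; in higher degrees the homology modulo `s`
    -- already vanishes.
    cases i with
    | zero =>
      rw [mem_boundariesMod_zero] at hz' ⊢
      rw [map_smul] at hz'
      exact hreg s hs' a haT ha _ hz'
    | succ i => exact ih hs' i hz

/-- Each variable adjoined after `T`, regular or not, raises the largest degree of nonzero homology
by at most one. -/
theorem cyclesMod_union_le [DecidableEq σ] (T : Finset σ)
    (hT : ∀ i, F.cyclesMod T (i + 1) ≤ F.boundariesMod T (i + 1))
    (U : Finset σ) (hU : Disjoint T U) : ∀ i, U.card < i →
      F.cyclesMod ↑(T ∪ U) i ≤ F.boundariesMod ↑(T ∪ U) i := by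
  induction U using Finset.induction_on with
  | empty =>
    rintro (_ | i) hi
    · simp at hi
    · rw [Finset.union_empty]; exact hT i
  | insert a U ha ih =>
    rw [Finset.disjoint_insert_right] at hU
    rintro (_ | i) hi
    · simp at hi
    rw [Finset.card_insert_of_notMem ha] at hi
    rw [Finset.union_insert, Finset.coe_insert]
    exact cyclesMod_insert_le (by simpa [ha] using hU.1) (ih hU.2 _ (by lia))
      fun z hz _ => ih hU.2 i (by lia) hz

/-- A homogeneous socle element of `M` modulo the variables in `T` yields a homogeneous class. -/
theorem exists_class_of_socle [DecidableEq σ] (T : Finset σ)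
    (hT : ∀ i, F.cyclesMod T (i + 1) ≤ F.boundariesMod T (i + 1)) {D : ℤ} {z : F.F 0}
    (hz : F.proj 0 D z = z) (hb : z ∉ F.boundariesMod T 0)
    (hann : ∀ c, (X c : MvPolynomial σ k) • z ∈ F.boundariesMod T 0)
    (U : Finset σ) (hU : Disjoint T U) :
    ∃ x ∈ F.cyclesMod ↑(T ∪ U) U.card, F.proj U.card (D + ∑ a ∈ U, w a) x = x ∧
      x ∉ F.boundariesMod ↑(T ∪ U) U.card ∧
      ∀ c, (X c : MvPolynomial σ k) • x ∈ F.boundariesMod ↑(T ∪ U) U.card := by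
  induction U using Finset.induction_on with
  | empty =>
    rw [Finset.card_empty, Finset.union_empty, Finset.sum_empty, add_zero]
    exact ⟨z, trivial, hz, hb, hann⟩
  | insert a U ha ih =>
    rw [Finset.disjoint_insert_right] at hU
    obtain ⟨x, -, hx, hxb, hxc⟩ := ih hU.2
    rw [Finset.card_insert_of_notMem ha, Finset.union_insert, Finset.coe_insert,
      Finset.sum_insert ha, add_comm (w a), ← add_assoc]
    exact exists_lift (by simpa [ha] using hU.1) (cyclesMod_union_le T hT U hU.2 _ (by lia))
      hx hxb hxc

/-- Removing a variable `a` of `U` lowers the homological degree by one and the internal degree by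
`w a`, so after all of `U` the class lands in degree `D` of `M / T M`. -/
theorem exists_class_zero [DecidableEq σ] (T : Finset σ)
    (hT : ∀ i, F.cyclesMod T (i + 1) ≤ F.boundariesMod T (i + 1))
    (U : Finset σ) (hU : Disjoint T U) (D : ℤ) (x : F.F U.card)
    (hx : x ∈ F.cyclesMod ↑(T ∪ U) U.card) (he : F.proj U.card (D + ∑ a ∈ U, w a) x = x)
    (hb : x ∉ F.boundariesMod ↑(T ∪ U) U.card) :
    ∃ z, F.proj 0 D z = z ∧ z ∉ F.boundariesMod T 0 := by
  induction U using Finset.induction_on with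
  | empty =>
    revert x
    rw [Finset.card_empty, Finset.union_empty, Finset.sum_empty, add_zero]
    exact fun x _ he hb => ⟨x, he, hb⟩
  | insert a U ha ih =>
    rw [Finset.disjoint_insert_right] at hU
    revert x
    rw [Finset.card_insert_of_notMem ha, Finset.union_insert, Finset.coe_insert,
      Finset.sum_insert ha, add_comm (w a), ← add_assoc]
    intro x hx he hb
    obtain ⟨z, hz, hze, hzb⟩ := exists_descent (by simpa [ha] using hU.1)
      (cyclesMod_union_le T hT U hU.2 _ (by lia)) hx he hb
    exact ih hU.2 z hz hze hzb

end GradedFreeResolution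

/-! ### Tensor products with a cyclic module -/

section TensorQuotient

variable {A : Type*} [CommRing A] {N N' : Type*} [AddCommGroup N] [Module A N] [AddCommGroup N']
  [Module A N'] (I : Ideal A)

theorem tmul_one_eq_zero_iff {x : N} :
    x ⊗ₜ[A] (1 : A ⧸ I) = 0 ↔ x ∈ I • (⊤ : Submodule A N) := by
  rw [← (TensorProduct.tensorQuotEquivQuotSMul N I).map_eq_zero_iff,
    ← map_one (Ideal.Quotient.mk I), TensorProduct.tensorQuotEquivQuotSMul_tmul_mk, one_smul,
    Submodule.Quotient.mk_eq_zero]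

theorem tmul_mk_eq (x : N) (p : A) : x ⊗ₜ[A] (Ideal.Quotient.mk I p) = (p • x) ⊗ₜ[A] 1 := by
  rw [TensorProduct.smul_tmul]
  congr 1
  rw [Algebra.smul_def, mul_one]
  rfl

/-- Allows homology of `F ⊗ A/I` to be computed with representatives in `F`. -/
theorem exists_tmul_one_eq (z : N ⊗[A] (A ⧸ I)) : ∃ x : N, x ⊗ₜ[A] 1 = z := by
  induction z with
  | zero => exact ⟨0, TensorProduct.zero_tmul _ _⟩
  | tmul x p =>
    obtain ⟨p, rfl⟩ := Ideal.Quotient.mk_surjective p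
    exact ⟨_, (tmul_mk_eq I x p).symm⟩
  | add y z hy hz =>
    obtain ⟨x, rfl⟩ := hy
    obtain ⟨x', rfl⟩ := hz
    exact ⟨x + x', TensorProduct.add_tmul _ _ _⟩

theorem tmul_one_mem_range_rTensor_iff (f : N →ₗ[A] N') {x : N'} :
    x ⊗ₜ[A] (1 : A ⧸ I) ∈ LinearMap.range (f.rTensor (A ⧸ I)) ↔
      x ∈ LinearMap.range f ⊔ I • (⊤ : Submodule A N') := by
  rw [Submodule.mem_sup]
  constructor
  · rintro ⟨z, hz⟩
    obtain ⟨y, rfl⟩ := exists_tmul_one_eq I z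
    rw [LinearMap.rTensor_tmul] at hz
    exact ⟨f y, ⟨y, rfl⟩, x - f y, (tmul_one_eq_zero_iff I).1 (by
      rw [TensorProduct.sub_tmul, hz, sub_self]), by abel⟩
  · rintro ⟨_, ⟨y, rfl⟩, r, hr, rfl⟩
    refine ⟨y ⊗ₜ 1, ?_⟩
    rw [LinearMap.rTensor_tmul, TensorProduct.add_tmul, (tmul_one_eq_zero_iff I).2 hr, add_zero]

end TensorQuotient

/-! ### Graded pieces of `Tor(M, k)` as homology modulo all variables -/

section TorPieces

variable {σ : Type} {k : Type u} [Field k] {w : σ → ℤ}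

theorem irrelevantIdeal_polyPiece (hw : ∀ a, 0 < w a) :
    irrelevantIdeal (polyPiece k w) = varIdeal k Set.univ := by
  apply le_antisymm
  · refine Ideal.span_le.2 ?_
    rintro p ⟨d, hd, hp⟩
    rw [SetLike.mem_coe, varIdeal, mem_ideal_span_X_image]
    intro t ht
    have h : Finsupp.weight w t = d := hp (mem_support_iff.1 ht)
    by_contra! hc
    have : t = 0 := Finsupp.ext fun i => hc i trivial
    rw [this, map_zero] at h
    exact hd.ne h
  · refine Ideal.span_mono ?_
    rintro _ ⟨a, -, rfl⟩
    exact ⟨w a, hw a, isWeightedHomogeneous_X k w a⟩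

namespace GradedFreeResolution

variable {M : Type u} [AddCommGroup M] [Module (MvPolynomial σ k) M] {ℳ : ℤ → AddSubgroup M}
  {F : GradedFreeResolution (polyPiece k w) ℳ}

theorem tmul_one_mem_cycles_iff (hw : ∀ a, 0 < w a) {i : ℕ} {x : F.F i} :
    x ⊗ₜ[MvPolynomial σ k] 1 ∈ F.cycles (MvPolynomial σ k ⧸ irrelevantIdeal (polyPiece k w)) i ↔
      x ∈ F.cyclesMod Set.univ i := by
  cases i with
  | zero => exact Iff.rfl
  | succ i =>
    simp only [cycles, cyclesMod, LinearMap.mem_ker, LinearMap.rTensor_tmul,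
      tmul_one_eq_zero_iff, Submodule.mem_comap]
    rw [irrelevantIdeal_polyPiece hw]

theorem tmul_one_mem_boundaries_iff (hw : ∀ a, 0 < w a) {i : ℕ} {x : F.F i} :
    x ⊗ₜ[MvPolynomial σ k] 1 ∈
      F.boundaries (MvPolynomial σ k ⧸ irrelevantIdeal (polyPiece k w)) i ↔
      x ∈ F.boundariesMod Set.univ i := by
  rw [boundaries, tmul_one_mem_range_rTensor_iff, boundariesMod, irrelevantIdeal_polyPiece hw]

theorem mem_gradedTensorPiece_iff {i : ℕ} {e : ℤ}
    {z : F.F i ⊗[MvPolynomial σ k] (MvPolynomial σ k ⧸ irrelevantIdeal (polyPiece k w))} :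
    z ∈ gradedTensorPiece (gradedFreePiece (polyPiece k w) (F.basis i) (F.deg i))
      (residuePiece (polyPiece k w)) e ↔ ∃ x, F.proj i e x = x ∧ x ⊗ₜ 1 = z := by
  constructor
  · intro hz
    induction hz using AddSubgroup.closure_induction with
    | mem z hz =>
      obtain ⟨a, b, rfl, x, hx, _, ⟨p, hp, rfl⟩, rfl⟩ := hz
      refine ⟨p • x, ?_, (tmul_mk_eq _ x p).symm⟩
      have h := smul_mem_gradedFreePiece w (F.basis i) (F.deg i) hp hx
      rw [proj, freeProj_of_mem h, if_pos (add_comm a b)]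
    | zero => exact ⟨0, map_zero _, TensorProduct.zero_tmul _ _⟩
    | add y z _ _ hy hz =>
      obtain ⟨x, hx, rfl⟩ := hy
      obtain ⟨x', hx', rfl⟩ := hz
      exact ⟨x + x', by rw [map_add, hx, hx'], TensorProduct.add_tmul _ _ _⟩
    | neg z _ hz =>
      obtain ⟨x, hx, rfl⟩ := hz
      exact ⟨-x, by rw [map_neg, hx], TensorProduct.neg_tmul _ _⟩
  · rintro ⟨x, hx, rfl⟩
    refine AddSubgroup.subset_closure ⟨e, 0, add_zero e, x, ?_, 1, ?_, rfl⟩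
    · rw [← hx]; exact freeProj_mem _ _ _ _ _
    · exact ⟨1, isWeightedHomogeneous_one k w, rfl⟩

/-- The bridge from the tensor product definition to homogeneous cycles modulo all variables. -/
theorem torPiece_ne_bot_iff (hw : ∀ a, 0 < w a) {i : ℕ} {e : ℤ} :
    F.torPiece (residuePiece (polyPiece k w)) i e ≠ ⊥ ↔
      ∃ x ∈ F.cyclesMod Set.univ i, F.proj i e x = x ∧ x ∉ F.boundariesMod Set.univ i := by
  rw [Ne, AddSubgroup.eq_bot_iff_forall]
  push Not
  constructor
  · rintro ⟨_, ⟨⟨z, hzc⟩, hz, rfl⟩, hne⟩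
    obtain ⟨x, hx, rfl⟩ := mem_gradedTensorPiece_iff.1 hz
    refine ⟨x, (tmul_one_mem_cycles_iff hw).1 hzc, hx, fun hb => hne ?_⟩
    exact (Submodule.Quotient.mk_eq_zero _).2 ((tmul_one_mem_boundaries_iff hw).2 hb)
  · rintro ⟨x, hxc, hx, hb⟩
    refine ⟨_, ⟨⟨x ⊗ₜ 1, (tmul_one_mem_cycles_iff hw).2 hxc⟩,
      mem_gradedTensorPiece_iff.2 ⟨x, hx, rfl⟩, rfl⟩, fun h => hb ?_⟩
    exact (tmul_one_mem_boundaries_iff hw).1 (Submodule.mem_comap.1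
      ((Submodule.Quotient.mk_eq_zero ((F.boundaries _ i).comap (F.cycles _ i).subtype)).1 h))

variable (F) in
theorem ε_mem_of_mem (hmul : ∀ d e, ∀ p ∈ polyPiece k w d, ∀ v ∈ ℳ e, p • v ∈ ℳ (d + e))
    {e : ℤ} {x : F.F 0} (hx : x ∈ gradedFreePiece (polyPiece k w) (F.basis 0) (F.deg 0) e) :
    F.ε x ∈ ℳ e := by
  rw [← (F.basis 0).linearCombination_repr x, Finsupp.linearCombination_apply, Finsupp.sum, map_sum]
  refine sum_mem fun j _ => ?_
  rw [map_smul]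
  simpa using hmul _ _ _ (hx j) _ (F.ε_mem j)

end GradedFreeResolution

theorem gradedEnd_eq {T : Type u} [AddCommGroup T] {𝒯 : ℤ → AddSubgroup T} {D : ℤ}
    (hD : 𝒯 D ≠ ⊥) (h : ∀ d, 𝒯 d ≠ ⊥ → d ≤ D) : gradedEnd 𝒯 = ((D : ℝ) : EReal) := by
  refine IsLUB.sSup_eq (IsGreatest.isLUB ⟨⟨D, hD, rfl⟩, ?_⟩)
  rintro _ ⟨d, hd, rfl⟩
  simpa using h d hd

end TorPieces

/-! ### Existence of graded resolutions and the value of `t_c` -/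

section Existence

variable {σ : Type} {k : Type u} [Field k] {w : σ → ℤ}

/-- Allowing every larger index set makes the statement additive in `x`: the finite sets of two
summands are merged. -/
theorem exists_sum_freeProj {F ι : Type u} [AddCommGroup F] [Module (MvPolynomial σ k) F]
    (b : Module.Basis ι (MvPolynomial σ k) F) (deg : ι → ℤ) (x : F) :
    ∃ E : Finset ℤ, ∀ E', E ⊆ E' → ∑ e ∈ E', freeProj w b deg e x = x := by
  classical
  have hadd : ∀ x y : F, (∃ E : Finset ℤ, ∀ E', E ⊆ E' → ∑ e ∈ E', freeProj w b deg e x = x) →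
      (∃ E : Finset ℤ, ∀ E', E ⊆ E' → ∑ e ∈ E', freeProj w b deg e y = y) →
      ∃ E : Finset ℤ, ∀ E', E ⊆ E' → ∑ e ∈ E', freeProj w b deg e (x + y) = x + y := by
    rintro x y ⟨E₁, h₁⟩ ⟨E₂, h₂⟩
    refine ⟨E₁ ∪ E₂, fun E' hE => ?_⟩
    simp only [map_add, Finset.sum_add_distrib]
    rw [h₁ E' (Finset.union_subset_left hE), h₂ E' (Finset.union_subset_right hE)]
  rw [← b.repr.symm_apply_apply x]
  generalize b.repr x = y
  induction y using Finsupp.induction_linear with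
  | zero => exact ⟨∅, fun E' _ => by simp⟩
  | add f g hf hg => rw [map_add]; exact hadd _ _ hf hg
  | single j p =>
    rw [b.repr_symm_single]
    induction p using MvPolynomial.induction_on' with
    | add p q hp hq => rw [add_smul]; exact hadd _ _ hp hq
    | monomial t c =>
      have ht : (monomial t c : MvPolynomial σ k) ∈ polyPiece k w (Finsupp.weight w t) :=
        isWeightedHomogeneous_monomial w t c rfl
      refine ⟨{Finsupp.weight w t + deg j}, fun E' hE => ?_⟩
      rw [Finset.sum_eq_single (Finsupp.weight w t + deg j)]
      · rw [freeProj_smul_basis, weightedHomogeneousComponent_of_mem ht, if_pos (by ring)]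
      · intro e _ he
        rw [freeProj_smul_basis, weightedHomogeneousComponent_of_mem ht,
          if_neg (fun h => he (by linarith)), zero_smul]
      · intro h; exact absurd (hE (Finset.mem_singleton_self _)) h

variable (k w) in
/-- A homogeneous submodule of a graded free module. -/
structure HomogeneousSyzygies where
  ι : Type u
  deg : ι → ℤ
  K : Submodule (MvPolynomial σ k) (ι →₀ MvPolynomial σ k)
  proj_mem : ∀ e, ∀ x ∈ K, freeProj w Finsupp.basisSingleOne deg e x ∈ K

namespace HomogeneousSyzygies

/-- The graded free module on the homogeneous elements of a homogeneous submodule. -/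
abbrev CoverIndex (P : HomogeneousSyzygies k w) : Type u :=
  Σ e : ℤ, {x // x ∈ P.K ∧ x ∈ gradedFreePiece (polyPiece k w) Finsupp.basisSingleOne P.deg e}

/-- The presentation of a homogeneous submodule by its homogeneous elements. -/
def coverMap (P : HomogeneousSyzygies k w) :
    (P.CoverIndex →₀ MvPolynomial σ k) →ₗ[MvPolynomial σ k] (P.ι →₀ MvPolynomial σ k) :=
  Finsupp.linearCombination _ fun j => j.2.1

theorem coverMap_basis_mem (P : HomogeneousSyzygies k w) (j : P.CoverIndex) :
    P.coverMap (Finsupp.basisSingleOne j) ∈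
      gradedFreePiece (polyPiece k w) Finsupp.basisSingleOne P.deg j.1 := by
  rw [coverMap, Finsupp.coe_basisSingleOne, Finsupp.linearCombination_single, one_smul]
  exact j.2.2.2

theorem range_coverMap (P : HomogeneousSyzygies k w) : LinearMap.range P.coverMap = P.K := by
  rw [coverMap, Finsupp.range_linearCombination]
  apply le_antisymm
  · rw [Submodule.span_le]
    rintro _ ⟨j, rfl⟩
    exact j.2.2.1
  · intro x hx
    obtain ⟨E, hE⟩ := exists_sum_freeProj (w := w) Finsupp.basisSingleOne P.deg x
    rw [← hE E subset_rfl]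
    exact Submodule.sum_mem _ fun e _ => Submodule.subset_span
      ⟨⟨e, _, P.proj_mem e x hx, freeProj_mem _ _ _ _ _⟩, rfl⟩

/-- The syzygies of the homogeneous elements of a homogeneous submodule. -/
def next (P : HomogeneousSyzygies k w) : HomogeneousSyzygies k w where
  ι := P.CoverIndex
  deg := Sigma.fst
  K := LinearMap.ker P.coverMap
  proj_mem e x hx := by
    rw [LinearMap.mem_ker] at hx ⊢
    rw [map_freeProj_free (b' := Finsupp.basisSingleOne) (deg' := P.deg) P.coverMap
      P.coverMap_basis_mem, hx, map_zero]

theorem coverMap_eq_zero_iff (P : HomogeneousSyzygies k w) (x : P.CoverIndex →₀ MvPolynomial σ k) :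
    P.coverMap x = 0 ↔ x ∈ Set.range P.next.coverMap :=
  (SetLike.ext_iff.1 P.next.range_coverMap x).symm

/-- The iterated syzygies. -/
def iterate (P : HomogeneousSyzygies k w) : ℕ → HomogeneousSyzygies k w
  | 0 => P
  | i + 1 => (P.iterate i).next

end HomogeneousSyzygies

variable {M : Type u} [AddCommGroup M] [Module (MvPolynomial σ k) M] {ℳ : ℤ → AddSubgroup M}

/-- `torEnd` is a supremum over resolutions, which over an empty family would be `⊥`. A resolution
arises by repeatedly covering a homogeneous module by the free module on all its homogeneous
elements. -/
theorem nonempty_gradedFreeResolution {π : ℤ → M →+ M}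
    (hπ : ∀ d, ∀ v ∈ ℳ d, ∀ e, π e v = if e = d then v else 0)
    (hmul : ∀ d e, ∀ p ∈ polyPiece k w d, ∀ v ∈ ℳ e, p • v ∈ ℳ (d + e))
    (hspan : Submodule.span (MvPolynomial σ k) (⋃ d, (ℳ d : Set M)) = ⊤) :
    Nonempty (GradedFreeResolution (polyPiece k w) ℳ) := by
  let ι : Type u := Σ d : ℤ, ℳ d
  let ε : (ι →₀ MvPolynomial σ k) →ₗ[MvPolynomial σ k] M :=
    Finsupp.linearCombination _ fun j => (j.2 : M)
  have hε : ∀ j : ι, ε (Finsupp.basisSingleOne j) ∈ ℳ j.1 := fun j => by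
    simp only [ε, Finsupp.coe_basisSingleOne, Finsupp.linearCombination_single, one_smul]
    exact j.2.2
  have hsurj : Function.Surjective ε := by
    rw [← LinearMap.range_eq_top, Finsupp.range_linearCombination, ← hspan]
    congr 1
    ext v
    simp [ι]
  let P : HomogeneousSyzygies k w :=
    { ι := ι
      deg := Sigma.fst
      K := LinearMap.ker ε
      proj_mem := fun e x hx => by
        rw [LinearMap.mem_ker] at hx ⊢
        rw [map_freeProj hπ hmul ε hε, hx, map_zero] }
  exact ⟨{
    F := fun i => (P.iterate i).ι →₀ MvPolynomial σ k
    ι := fun i => (P.iterate i).ι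
    basis := fun i => Finsupp.basisSingleOne
    deg := fun i => (P.iterate i).deg
    d := fun i => (P.iterate i).coverMap
    ε := ε
    d_mem := fun i j => (P.iterate i).coverMap_basis_mem j
    ε_mem := hε
    ε_surjective := hsurj
    exact_zero := fun x => (SetLike.ext_iff.1 P.range_coverMap x).symm
    exact_succ := fun i x => (P.iterate i).coverMap_eq_zero_iff x }⟩

/-- Let the variables in `T` form a regular sequence on `M` in any order, and let `D` be the top
degree of `M / T M`. Then `t_c(M)` is `D` plus the sum of the degrees of the `c` other variables. -/
theorem torEnd_eq_of_regular [Fintype σ] [DecidableEq σ] (hw : ∀ a, 0 < w a) {π : ℤ → M →+ M}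
    (hπ : ∀ d, ∀ v ∈ ℳ d, ∀ e, π e v = if e = d then v else 0)
    (hmul : ∀ d e, ∀ p ∈ polyPiece k w d, ∀ v ∈ ℳ e, p • v ∈ ℳ (d + e))
    (hspan : Submodule.span (MvPolynomial σ k) (⋃ d, (ℳ d : Set M)) = ⊤) (T : Finset σ)
    (hreg : ∀ s ⊆ T, ∀ a ∈ T, a ∉ s → ∀ v : M,
      (X a : MvPolynomial σ k) • v ∈
        varIdeal k (s : Set σ) • (⊤ : Submodule (MvPolynomial σ k) M) →
      v ∈ varIdeal k (s : Set σ) • (⊤ : Submodule (MvPolynomial σ k) M)) {D : ℤ}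
    (hD : ∃ v ∈ ℳ D, v ∉ varIdeal k (T : Set σ) • (⊤ : Submodule (MvPolynomial σ k) M))
    (htop : ∀ d, D < d → ∀ v ∈ ℳ d,
      v ∈ varIdeal k (T : Set σ) • (⊤ : Submodule (MvPolynomial σ k) M)) :
    torEnd (polyPiece k w) ℳ Tᶜ.card = (((D + ∑ a ∈ Tᶜ, w a : ℤ) : ℝ) : EReal) := by
  have := nonempty_gradedFreeResolution hπ hmul hspan
  rw [torEnd]
  -- Every resolution gives the same value, so no comparison between resolutions is needed.
  refine (iSup_congr fun F => ?_).trans ciSup_const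
  have hT := F.cyclesMod_le_of_regular T hreg
  have huniv : ((T ∪ Tᶜ : Finset σ) : Set σ) = Set.univ := by simp
  have hε := fun e x => map_freeProj hπ hmul F.ε F.ε_mem e x
  refine gradedEnd_eq ?_ fun d hd => ?_
  · rw [GradedFreeResolution.torPiece_ne_bot_iff hw]
    obtain ⟨v, hv, hvT⟩ := hD
    obtain ⟨z, rfl⟩ := F.ε_surjective v
    have hz : F.ε (F.proj 0 D z) = F.ε z := by rw [hε, hπ D _ hv, if_pos rfl]
    obtain ⟨x, hx, hxe, hxb, -⟩ := GradedFreeResolution.exists_class_of_socle T hT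
      (z := F.proj 0 D z) (by
        rw [GradedFreeResolution.proj, freeProj_of_mem (freeProj_mem _ _ _ _ _), if_pos rfl])
      (by rwa [GradedFreeResolution.mem_boundariesMod_zero, hz]) (fun c => by
        rw [GradedFreeResolution.mem_boundariesMod_zero, map_smul, hz]
        exact htop _ (by linarith [hw c]) _ (hmul _ _ _ (isWeightedHomogeneous_X k w c) _ hv))
      Tᶜ disjoint_compl_right
    rw [huniv] at hx hxb
    exact ⟨x, hx, hxe, hxb⟩
  · rw [GradedFreeResolution.torPiece_ne_bot_iff hw] at hd
    obtain ⟨x, hx, hxe, hxb⟩ := hd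
    by_contra! hlt
    rw [← huniv] at hx hxb
    obtain ⟨z, hz, hzb⟩ := GradedFreeResolution.exists_class_zero T hT Tᶜ disjoint_compl_right
      (d - ∑ a ∈ Tᶜ, w a) x hx (by rwa [sub_add_cancel]) hxb
    refine hzb (GradedFreeResolution.mem_boundariesMod_zero.2 ?_)
    rw [← hz]
    exact htop _ (by linarith) _ (F.ε_mem_of_mem hmul (freeProj_mem _ _ _ _ _))

end Existence

/-! ### The Veronese ring as a module over `S` -/

section Veronese

variable {k : Type u} [Field k] {n m : ℕ}

theorem weight_one_int_eq_degree (t : Fin n →₀ ℕ) :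
    Finsupp.weight (fun _ : Fin n => (1 : ℤ)) t = (t.degree : ℤ) := by
  simp [Finsupp.weight_apply, Finsupp.degree_apply, Finsupp.sum]

theorem mem_veronese_iff {p : MvPolynomial (Fin n) k} :
    p ∈ veronese k n m ↔ ∀ t ∈ p.support, m ∣ t.degree := by
  constructor
  · intro hp t ht
    change p ∈ ⨆ i : ℕ, homogeneousSubmodule (Fin n) k (i * m) at hp
    rw [mem_support_iff] at ht
    by_contra hdvd
    apply ht
    induction hp using Submodule.iSup_induction' with
    | zero => simp
    | add x y _ _ hx hy =>
      rw [coeff_add]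
      by_cases h : coeff t x = 0
      · by_cases h' : coeff t y = 0
        · rw [h, h', add_zero]
        · exact absurd (hy h') h'
      · exact absurd (hx h) h
    | mem i x hx =>
      by_contra h
      exact h (IsHomogeneous.coeff_eq_zero hx fun h' => hdvd ⟨i, by rw [h', mul_comm]⟩)
  · intro h
    rw [p.as_sum]
    refine sum_mem fun t ht => ?_
    obtain ⟨i, hi⟩ := h t ht
    exact Submodule.mem_iSup_of_mem i (isHomogeneous_monomial _ (by rw [hi, mul_comm]))

theorem monomial_mem_veronese {t : Fin n →₀ ℕ} (ht : m ∣ t.degree) (c : k) :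
    monomial t c ∈ veronese k n m := by
  classical
  rw [mem_veronese_iff]
  intro s hs
  rw [Finset.mem_singleton.1 (support_monomial_subset hs)]
  exact ht

/-- An additive subgroup of the Veronese ring that contains the monomials of an element contains
the element. -/
theorem mem_addSubgroup_of_monomials (H : AddSubgroup (veronese k n m)) (v : veronese k n m)
    (h : ∀ t ∈ (v : MvPolynomial (Fin n) k).support, ∀ (c : k) (ht : m ∣ t.degree),
      ⟨monomial t c, monomial_mem_veronese ht c⟩ ∈ H) : v ∈ H := by
  have : (v : MvPolynomial (Fin n) k) ∈ H.map (veronese k n m).val.toLinearMap.toAddMonoidHom := by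
    rw [(v : MvPolynomial (Fin n) k).as_sum]
    refine sum_mem fun t ht => ?_
    exact ⟨_, h t ht _ (mem_veronese_iff.1 v.2 t ht), rfl⟩
  obtain ⟨v', hv', h'⟩ := this
  exact (Subtype.ext h' : v' = v) ▸ hv'

theorem adjoin_veroneseGen :
    Algebra.adjoin k (Set.range (veroneseGen k n m)) = ⊤ := by
  rw [Algebra.eq_top_iff]
  intro v
  refine mem_addSubgroup_of_monomials
    (Algebra.adjoin k (Set.range (veroneseGen k n m))).toSubmodule.toAddSubgroup v
    fun t hts c ht => ?_
  clear hts
  change _ ∈ Algebra.adjoin k (Set.range (veroneseGen k n m))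
  obtain ⟨j, hj⟩ := ht
  induction j generalizing t with
  | zero =>
    have h0 : t = 0 := by rwa [mul_zero, Finsupp.degree_eq_zero_iff] at hj
    have : (⟨monomial t c, monomial_mem_veronese ⟨0, hj⟩ c⟩ : veronese k n m) =
        algebraMap k _ c := by
      subst h0; rfl
    rw [this]
    exact Subalgebra.algebraMap_mem _ _
  | succ j ih =>
    obtain ⟨s, hst, hs⟩ := Finsupp.exists_le_degree_eq t m (by rw [hj]; nlinarith)
    have hsub : (t - s).degree = m * j := by
      have : (t - s).degree + s.degree = t.degree := by rw [← map_add, tsub_add_cancel_of_le hst]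
      rw [hs, hj, mul_add] at this
      lia
    have : (⟨monomial t c, monomial_mem_veronese ⟨j + 1, hj⟩ c⟩ : veronese k n m) =
        ⟨monomial (t - s) c, monomial_mem_veronese ⟨j, hsub⟩ c⟩ * veroneseGen k n m ⟨s, hs⟩ := by
      apply Subtype.ext
      simp [veroneseGen, monomial_mul, tsub_add_cancel_of_le hst]
    rw [this]
    exact Subalgebra.mul_mem _ (ih _ hsub) (Algebra.subset_adjoin ⟨_, rfl⟩)

theorem isMinimalGenerators_veroneseGen (hm : 0 < m) :
    IsMinimalGenerators (veronese k n m) (veroneseGen k n m) (fun _ => m) where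
  pos _ := hm
  homogeneous s := isHomogeneous_monomial 1 s.2
  generate := adjoin_veroneseGen
  minimal S hS := by
    classical
    rw [Set.eq_univ_iff_forall]
    intro t
    by_contra ht
    -- Without the generator `t`, its monomial is unreachable: degrees in the ring are multiples of
    -- `m`, so a product contributing to degree `m` has a factor in degree zero.
    have key : ∀ v ∈ Algebra.adjoin k (veroneseGen k n m '' S),
        coeff t.1 (v : MvPolynomial (Fin n) k) = 0 := by
      intro v hv
      induction hv using Algebra.adjoin_induction with
      | mem v hv =>
        obtain ⟨s, hs, rfl⟩ := hv
        have : s.1 ≠ t.1 := fun h => ht (Subtype.ext h ▸ hs)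
        simp [veroneseGen, this]
      | algebraMap c =>
        have : (0 : Fin n →₀ ℕ) ≠ t.1 := fun h => hm.ne' (by rw [← t.2, ← h, map_zero])
        change coeff t.1 (C c) = 0
        rw [coeff_C, if_neg this]
      | add x y _ _ hx hy => simp [hx, hy]
      | mul x y _ _ hx hy =>
        rw [MulMemClass.coe_mul, coeff_mul]
        refine Finset.sum_eq_zero fun ab hab => ?_
        rw [Finset.HasAntidiagonal.mem_antidiagonal] at hab
        by_contra h
        obtain ⟨i, hi⟩ := mem_veronese_iff.1 x.2 ab.1 (mem_support_iff.2 (left_ne_zero_of_mul h))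
        have hdeg : ab.1.degree + ab.2.degree = m := by rw [← map_add, hab, t.2]
        have hi' : i = 0 ∨ i = 1 := by
          have : m * i ≤ m * 1 := by lia
          have := Nat.le_of_mul_le_mul_left this hm
          lia
        rcases hi' with rfl | rfl
        · rw [mul_zero, Finsupp.degree_eq_zero_iff] at hi
          rw [hi, zero_add] at hab
          exact h (by rw [hab, hy, mul_zero])
        · have : ab.2 = 0 := by rw [← Finsupp.degree_eq_zero_iff]; lia
          rw [this, add_zero] at hab
          exact h (by rw [hab, hx, zero_mul])
    have := key (veroneseGen k n m t) (by rw [hS]; trivial)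
    simp [veroneseGen] at this

variable (k n m) in
/-- The polynomial ring on the monomials of degree `m` acts on the Veronese ring. -/
@[reducible] def veroneseModule :
    Module (MvPolynomial (VeroneseIndex n m) k) (veronese k n m) :=
  Module.compHom (veronese k n m)
    (aeval (veroneseGen k n m) : MvPolynomial (VeroneseIndex n m) k →ₐ[k] veronese k n m).toRingHom

attribute [local instance] veroneseModule

theorem coe_veronese_smul (p : MvPolynomial (VeroneseIndex n m) k) (v : veronese k n m) :
    ((p • v : veronese k n m) : MvPolynomial (Fin n) k) =
      aeval (fun s : VeroneseIndex n m => monomial s.1 (1 : k)) p * v := by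
  change ((aeval (veroneseGen k n m) p * v : veronese k n m) : MvPolynomial (Fin n) k) = _
  rw [MulMemClass.coe_mul]
  congr 1
  have : (veronese k n m).val.comp (aeval (veroneseGen k n m)) =
      aeval (fun s : VeroneseIndex n m => monomial s.1 (1 : k)) := by
    ext s : 1
    simp [veroneseGen]
  exact DFunLike.congr_fun this p

variable (n m) in
/-- The exponent of the `m`th power of a variable. -/
def purePower (i : Fin n) : VeroneseIndex n m := ⟨Finsupp.single i m, Finsupp.degree_single i m⟩

/-- A monomial divisible by `x_i ^ m` stays in the Veronese ring after the division, since its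
degree drops by `m`. This makes regularity and the top degree questions about exponents. -/
theorem mem_varIdeal_smul_veronese_iff {s : Set (VeroneseIndex n m)}
    (hs : s ⊆ Set.range (purePower n m)) {v : veronese k n m} :
    v ∈ varIdeal k s • (⊤ : Submodule (MvPolynomial (VeroneseIndex n m) k) (veronese k n m)) ↔
      ∀ t ∈ (v : MvPolynomial (Fin n) k).support, ∃ i, purePower n m i ∈ s ∧ m ≤ t i := by
  constructor
  · intro hv
    have hJ : (v : MvPolynomial (Fin n) k) ∈
        Ideal.span ((fun t => monomial t (1 : k)) '' (Subtype.val '' s)) := by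
      induction hv using Submodule.smul_induction_on' with
      | smul p hp v _ =>
        rw [coe_veronese_smul]
        refine Ideal.mul_mem_right _ _ ?_
        have : varIdeal k s ≤ (Ideal.span ((fun t => monomial t (1 : k)) '' (Subtype.val '' s))).comap
            (aeval (fun s : VeroneseIndex n m => monomial s.1 (1 : k))) := by
          rw [Ideal.span_le]
          rintro _ ⟨a, ha, rfl⟩
          rw [SetLike.mem_coe, Ideal.mem_comap, aeval_X]
          exact Ideal.subset_span ⟨a.1, ⟨a, ha, rfl⟩, rfl⟩
        exact this hp
      | add x _ y _ hx hy => exact add_mem hx hy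
    rw [mem_ideal_span_monomial_image] at hJ
    intro t ht
    obtain ⟨_, ⟨a, ha, rfl⟩, hle⟩ := hJ t ht
    obtain ⟨i, rfl⟩ := hs ha
    exact ⟨i, ha, by simpa [purePower] using hle i⟩
  · intro h
    refine mem_addSubgroup_of_monomials (varIdeal k s •
      (⊤ : Submodule (MvPolynomial (VeroneseIndex n m) k) (veronese k n m))).toAddSubgroup v
      fun t ht c hdvd => ?_
    obtain ⟨i, hi, hle⟩ := h t ht
    have hle' : Finsupp.single i m ≤ t := Finsupp.single_le_iff.2 hle
    have hadd : t - Finsupp.single i m + Finsupp.single i m = t := tsub_add_cancel_of_le hle'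
    have hdvd' : m ∣ (t - Finsupp.single i m).degree := by
      rw [← hadd, map_add, Finsupp.degree_single] at hdvd
      exact (Nat.dvd_add_iff_left (dvd_refl m)).2 hdvd
    have heq : (⟨monomial t c, monomial_mem_veronese hdvd c⟩ : veronese k n m) =
        (X (purePower n m i) : MvPolynomial (VeroneseIndex n m) k) •
          (⟨monomial (t - Finsupp.single i m) c, monomial_mem_veronese hdvd' c⟩ :
            veronese k n m) := by
      apply Subtype.ext
      rw [coe_veronese_smul, aeval_X, purePower]
      simp [monomial_mul, add_comm _ (t - _), hadd]
    rw [heq]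
    exact Submodule.smul_mem_smul (Ideal.subset_span ⟨_, hi, rfl⟩) trivial

theorem coe_mem_subalgebraPiece_iff {R : Subalgebra k (MvPolynomial (Fin n) k)} {d : ℤ} {v : R} :
    v ∈ subalgebraPiece R d ↔
      ∀ t ∈ (v : MvPolynomial (Fin n) k).support, (t.degree : ℤ) = d := by
  change IsWeightedHomogeneous _ _ _ ↔ _
  simp only [IsWeightedHomogeneous, weight_one_int_eq_degree, mem_support_iff]
  exact ⟨fun h t ht => h ht, fun h t ht => h t ht⟩

variable (k n m) in
/-- The projection of the Veronese ring onto its component of degree `e`. -/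
def veroneseProj (e : ℤ) : veronese k n m →+ veronese k n m where
  toFun v := ⟨weightedHomogeneousComponent (fun _ => (1 : ℤ)) e v.1, by
    classical
    rw [mem_veronese_iff, support_weightedHomogeneousComponent]
    exact fun t ht => mem_veronese_iff.1 v.2 t (Finset.mem_filter.1 ht).1⟩
  map_zero' := Subtype.ext (by simp)
  map_add' x y := Subtype.ext (by simp)

theorem veroneseProj_of_mem {d : ℤ} {v : veronese k n m}
    (hv : v ∈ subalgebraPiece (veronese k n m) d) (e : ℤ) :
    veroneseProj k n m e v = if e = d then v else 0 := by
  apply Subtype.ext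
  change weightedHomogeneousComponent _ e v.1 = _
  rw [weightedHomogeneousComponent_of_mem (show v.1 ∈ _ from hv)]
  split_ifs <;> rfl

theorem smul_mem_subalgebraPiece_veronese {d e : ℤ} {p : MvPolynomial (VeroneseIndex n m) k}
    (hp : p ∈ polyPiece k (fun _ : VeroneseIndex n m => (m : ℤ)) d) {v : veronese k n m}
    (hv : v ∈ subalgebraPiece (veronese k n m) e) :
    p • v ∈ subalgebraPiece (veronese k n m) (d + e) := by
  change IsWeightedHomogeneous _ ((p • v : veronese k n m) : MvPolynomial (Fin n) k) _
  rw [coe_veronese_smul]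
  refine IsWeightedHomogeneous.mul ?_ hv
  rw [aeval_eq_eval₂Hom, coe_eval₂Hom, eval₂_eq]
  refine sum_mem (S := weightedHomogeneousSubmodule k (fun _ : Fin n => (1 : ℤ)) d) fun t ht => ?_
  rw [← hp (mem_support_iff.1 ht), Finsupp.weight_apply, Finsupp.sum]
  refine IsWeightedHomogeneous.C_mul (IsWeightedHomogeneous.prod _ _ _ fun a _ => ?_) _
  refine IsWeightedHomogeneous.pow ?_ _
  refine isWeightedHomogeneous_monomial _ _ _ ?_
  rw [weight_one_int_eq_degree, a.2]

theorem span_iUnion_subalgebraPiece_veronese :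
    Submodule.span (MvPolynomial (VeroneseIndex n m) k)
      (⋃ d, (subalgebraPiece (veronese k n m) d : Set (veronese k n m))) = ⊤ := by
  rw [eq_top_iff]
  intro v _
  refine mem_addSubgroup_of_monomials (Submodule.span (MvPolynomial (VeroneseIndex n m) k)
    (⋃ d, (subalgebraPiece (veronese k n m) d : Set (veronese k n m)))).toAddSubgroup v
    fun t _ c ht => Submodule.subset_span (Set.mem_iUnion.2 ⟨t.degree, ?_⟩)
  exact isWeightedHomogeneous_monomial _ _ _ (weight_one_int_eq_degree t)

variable (k n m) in
/-- The end of the last nonzero `Tor` of the Veronese ring. -/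
theorem veroneseSyzygyEnd_eq (hm : 0 < m) : ∃ c : ℕ, veroneseSyzygyEnd k n m c =
    (((n * (m - 1) / m * m + c * m : ℕ) : ℝ) : EReal) := by
  classical
  have : Finite (VeroneseIndex n m) := (Finsupp.finite_of_degree_eq m).to_subtype
  have := Fintype.ofFinite (VeroneseIndex n m)
  let T : Finset (VeroneseIndex n m) := Finset.univ.image (purePower n m)
  have hT : (T : Set (VeroneseIndex n m)) ⊆ Set.range (purePower n m) := by simp [T]
  have hpT : ∀ i, purePower n m i ∈ T := fun i => Finset.mem_image_of_mem _ (Finset.mem_univ i)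
  refine ⟨Tᶜ.card, ?_⟩
  refine (torEnd_eq_of_regular (w := fun _ : VeroneseIndex n m => (m : ℤ))
    (ℳ := subalgebraPiece (veronese k n m)) (D := ((n * (m - 1) / m * m : ℕ) : ℤ))
    (fun _ => by exact_mod_cast hm) (π := veroneseProj k n m)
    (fun d v hv e => veroneseProj_of_mem hv e)
    (fun d e p hp v hv => smul_mem_subalgebraPiece_veronese hp hv)
    span_iUnion_subalgebraPiece_veronese T ?_ ?_ ?_).trans ?_
  · intro s hs a ha has v hv
    have hs' := (Finset.coe_subset.2 hs).trans hT
    rw [mem_varIdeal_smul_veronese_iff hs'] at hv ⊢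
    intro t ht
    obtain ⟨i, rfl⟩ := hT ha
    obtain ⟨j, hj, hle⟩ := hv (Finsupp.single i m + t) (by
      rw [coe_veronese_smul, aeval_X, purePower, mem_support_iff, coeff_monomial_mul, one_mul]
      exact mem_support_iff.1 ht)
    have hij : i ≠ j := fun h => has (h ▸ hj)
    exact ⟨j, hj, by simpa [Finsupp.single_apply, hij] using hle⟩
  -- A monomial dividing `(x_1 ⋯ x_n) ^ (m - 1)` whose degree is the largest multiple of `m` not
  -- exceeding `n (m - 1)`.
  · obtain ⟨t, hle, ht⟩ := Finsupp.exists_le_degree_eq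
      (Finsupp.equivFunOnFinite.symm (fun _ : Fin n => m - 1)) (n * (m - 1) / m * m) (by
        rw [Finsupp.degree_eq_sum]
        simpa using Nat.div_mul_le_self _ _)
    have hdvd : m ∣ t.degree := ht ▸ Dvd.intro_left _ rfl
    refine ⟨⟨monomial t 1, monomial_mem_veronese hdvd 1⟩, ?_, ?_⟩
    · exact isWeightedHomogeneous_monomial _ _ _ (by rw [weight_one_int_eq_degree, ht])
    · rw [mem_varIdeal_smul_veronese_iff hT]
      intro h
      obtain ⟨i, -, hi⟩ := h t (by simp)
      have := hle i
      simp only [Finsupp.equivFunOnFinite_symm_apply_apply] at this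
      lia
  · intro d hd v hv
    rw [mem_varIdeal_smul_veronese_iff hT]
    intro t ht
    have htd := coe_mem_subalgebraPiece_iff.1 hv t ht
    obtain ⟨j, hj⟩ := mem_veronese_iff.1 v.2 t ht
    by_contra! hc
    have hle : t.degree ≤ n * (m - 1) := by
      rw [Finsupp.degree_eq_sum]
      refine (Finset.sum_le_card_nsmul _ _ (m - 1) fun i _ => ?_).trans (by simp)
      have := hc i (hpT i)
      lia
    have hj' : j ≤ n * (m - 1) / m := by
      rw [Nat.le_div_iff_mul_le hm, mul_comm, ← hj]; exact hle
    have : t.degree ≤ n * (m - 1) / m * m := by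
      rw [hj, mul_comm]; exact Nat.mul_le_mul_right _ hj'
    lia
  · rw [Finset.sum_const, nsmul_eq_mul]
    push_cast
    rfl

end Veronese

/-! ### Scalar actions of cyclic groups -/

section ScalarAction

variable {k : Type u} [Field k] {n m : ℕ} {G : Type*} [Group G]

/-- The representation on `kⁿ` in which a group acts through a character by scalars. -/
def scalarRepresentation (n : ℕ) (χ : G →* kˣ) : Representation k G (Fin n → k) :=
  ((algebraMap k (Module.End k (Fin n → k))).toMonoidHom.comp (Units.coeHom k)).comp χ

theorem scalarRepresentation_apply (χ : G →* kˣ) (g : G) :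
    scalarRepresentation n χ g = (χ g : k) • LinearMap.id :=
  Algebra.algebraMap_eq_smul_one (A := Module.End k (Fin n → k)) (χ g : k)

theorem polyAction_scalarRepresentation (χ : G →* kˣ) (g : G) (p : MvPolynomial (Fin n) k)
    (t : Fin n →₀ ℕ) :
    coeff t (polyAction (scalarRepresentation n χ) g p) = (χ g : k) ^ t.degree * coeff t p := by
  have hX : ∀ j : Fin n, polyAction (scalarRepresentation n χ) g (X j) = C (χ g : k) * X j := by
    intro j
    simp [polyAction, scalarRepresentation_apply, Pi.single_apply, smul_eq_C_mul]
  induction p using MvPolynomial.induction_on' with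
  | add p q hp hq => simp only [map_add, coeff_add, hp, hq, mul_add]
  | monomial s c =>
    have : polyAction (scalarRepresentation n χ) g (monomial s c) =
        monomial s ((χ g : k) ^ s.degree * c) := by
      rw [monomial_eq, map_mul, Finsupp.prod, map_prod]
      simp only [map_pow, hX, mul_pow, Finset.prod_mul_distrib, Finset.prod_pow_eq_pow_sum]
      rw [monomial_eq, Finsupp.prod, Finsupp.degree_apply, C_mul, C_pow,
        ← algebraMap_eq, AlgHom.commutes]
      ring
    rw [this, coeff_monomial, coeff_monomial]
    split_ifs with h
    · rw [h]
    · rw [mul_zero]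

/-- The generator scales a monomial of degree `d` by `w ^ d`, which is `1` exactly when `m ∣ d`. -/
theorem polyInvariants_scalarRepresentation {χ : G →* kˣ} {g : G} {w : k}
    (hw : IsPrimitiveRoot w m) (hχ : (χ g : k) = w) (hg : Subgroup.zpowers g = ⊤) :
    polyInvariants (scalarRepresentation n χ) = veronese k n m := by
  have hmem : ∀ p, p ∈ polyInvariants (scalarRepresentation n χ) ↔
      ∀ x, polyAction (scalarRepresentation n χ) x p = p := by
    intro p
    simp [polyInvariants, Algebra.mem_iInf, AlgHom.mem_equalizer]
  ext p
  rw [hmem, mem_veronese_iff]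
  constructor
  · intro h t ht
    have := congrArg (coeff t) (h g)
    rw [polyAction_scalarRepresentation, hχ] at this
    exact hw.dvd_of_pow_eq_one _ (mul_eq_right₀ (mem_support_iff.1 ht) |>.1 this)
  · intro h x
    obtain ⟨z, rfl⟩ : x ∈ Subgroup.zpowers g := hg ▸ Subgroup.mem_top x
    ext t
    rw [polyAction_scalarRepresentation]
    by_cases ht : coeff t p = 0
    · rw [ht, mul_zero]
    · obtain ⟨j, hj⟩ := h t (mem_support_iff.2 ht)
      have h1 : χ g ^ m = 1 := Units.ext (by simpa [hχ] using hw.pow_eq_one)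
      have : (χ (g ^ z)) ^ t.degree = 1 := by
        rw [map_zpow, hj, pow_mul, ← zpow_natCast (χ g ^ z) m, zpow_comm, zpow_natCast, h1, one_zpow,
          one_pow]
      rw [← Units.val_pow_eq_pow_val, this, Units.val_one, one_mul]

/-- Forms of degree `m` are themselves invariant, while every monomial in the Hilbert ideal has
degree at least `m`. The lower bound is tested on a power of a variable, hence `0 < n`. -/
theorem tauG_eq_of_polyInvariants_eq {ρ : Representation k G (Fin n → k)} (hm : 0 < m)
    (hn : 0 < n) (hρ : polyInvariants ρ = veronese k n m) : tauG ρ = m := by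
  classical
  have hI : ∀ p ∈ hilbertIdeal ρ, ∀ t ∈ p.support, m ≤ t.degree := by
    have hle : hilbertIdeal ρ ≤
        Ideal.span ((fun t => monomial t (1 : k)) '' {t : Fin n →₀ ℕ | m ≤ t.degree}) := by
      rw [hilbertIdeal, Ideal.span_le]
      rintro p ⟨hp, d, hd, hpd⟩
      rw [SetLike.mem_coe, mem_ideal_span_monomial_image]
      intro t ht
      refine ⟨t, ?_, le_rfl⟩
      rw [hρ] at hp
      have htd : t.degree = d := by
        by_contra h
        exact mem_support_iff.1 ht (hpd.coeff_eq_zero h)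
      exact Nat.le_of_dvd (htd ▸ hd) (mem_veronese_iff.1 hp t ht)
    intro p hp t ht
    obtain ⟨s, hs, hst⟩ := mem_ideal_span_monomial_image.1 (hle hp) t ht
    exact le_trans hs (Finsupp.degree_mono hst)
  refine IsLeast.csInf_eq ⟨⟨hm, fun p hp => Ideal.subset_span ⟨?_, m, hm, hp⟩⟩, ?_⟩
  · rw [hρ]
    exact Submodule.mem_iSup_of_mem 1 (by rwa [one_mul])
  · rintro d ⟨-, h⟩
    have hd : (Finsupp.single (⟨0, hn⟩ : Fin n) d).degree = d := Finsupp.degree_single _ _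
    have := hI _ (h (monomial (Finsupp.single ⟨0, hn⟩ d) 1) (isHomogeneous_monomial _ hd))
      (Finsupp.single ⟨0, hn⟩ d) (by simp)
    rwa [hd] at this

theorem not_derksenInequalities_of_lt {ρ : Representation k G (Fin n → k)} (hm : 0 < m)
    (hρ : polyInvariants ρ = veronese k n m) {i : ℕ}
    (hi : (((i + 1) * tauG ρ : ℕ) : EReal) < veroneseSyzygyEnd k n m i) :
    ¬ DerksenInequalities ρ := by
  intro h
  have : Finite (VeroneseIndex n m) := (Finsupp.finite_of_degree_eq m).to_subtype
  unfold DerksenInequalities at h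
  rw [hρ] at h
  exact absurd (h _ (veroneseGen k n m) (fun _ => m) (isMinimalGenerators_veroneseGen hm) i).1
    (not_le.2 hi)

end ScalarAction

/-! ### Numerical estimates and the main theorem -/

theorem ceil_div_mul_eq (n m : ℕ) (hm : 0 < m) :
    (n : ℝ) * m - (⌈(n : ℝ) / m⌉ : ℝ) * m = ((n * (m - 1) / m * m : ℕ) : ℝ) := by
  have hm' : (0 : ℝ) < m := by exact_mod_cast hm
  -- Since `n (m - 1) / m = n - n / m`, its floor is `n - ⌈n / m⌉`.
  have hc : ⌈(n : ℝ) / m⌉ = (n : ℤ) - ((n * (m - 1) / m : ℕ) : ℤ) := by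
    have h1 := Nat.div_mul_le_self (n * (m - 1)) m
    have h2 := Nat.lt_div_mul_add (a := n * (m - 1)) hm
    generalize n * (m - 1) / m = q at h1 h2
    have h1' : (q : ℝ) * m ≤ n * (m - 1) := by
      have : ((q * m : ℕ) : ℝ) ≤ ((n * (m - 1) : ℕ) : ℝ) := by exact_mod_cast h1
      rwa [Nat.cast_mul, Nat.cast_mul, Nat.cast_sub hm, Nat.cast_one] at this
    have h2' : (n : ℝ) * (m - 1) < q * m + m := by
      have : ((n * (m - 1) : ℕ) : ℝ) < ((q * m + m : ℕ) : ℝ) := by exact_mod_cast h2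
      rwa [Nat.cast_add, Nat.cast_mul, Nat.cast_mul, Nat.cast_sub hm, Nat.cast_one] at this
    rw [Int.ceil_eq_iff, lt_div_iff₀ hm', div_le_iff₀ hm']
    push_cast
    constructor <;> nlinarith
  rw [hc, Nat.cast_mul, Int.cast_sub, Int.cast_natCast, Int.cast_natCast]
  ring

/-- Says that `M / T M` reaches degree `2m`, which is what `t_c > (c + 1) m` requires. -/
theorem two_le_mul_sub_one_div {n m : ℕ} (h : n = 3 ∧ 3 ≤ m ∨ 4 ≤ n ∧ m ≠ 1) (hm : 0 < m) :
    2 ≤ n * (m - 1) / m := by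
  rw [Nat.le_div_iff_mul_le hm]
  obtain ⟨l, rfl⟩ : ∃ l, m = l + 1 := ⟨m - 1, by lia⟩
  rw [Nat.add_sub_cancel]
  rcases h with ⟨rfl, h⟩ | ⟨h, h'⟩
  · lia
  · have : 4 * l ≤ n * l := Nat.mul_le_mul_right _ h
    lia

end

theorem mainTheorem3 {k : Type*} [Field k] (n m : ℕ) (hm : 0 < m) :
    (IsMinimalGenerators (veronese k n m) (veroneseGen k n m) (fun _ => m) ∧
      ∃ i : ℕ, veroneseSyzygyEnd k n m i - ((((i : ℝ) * m : ℝ)) : EReal) =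
        (((n : ℝ) * m - (⌈(n : ℝ) / m⌉ : ℝ) * m : ℝ) : EReal)) ∧
    ∀ (w : k), IsPrimitiveRoot w m →
      ∀ {G : Type*} [Group G] (g : G), Subgroup.zpowers g = ⊤ → Nat.card G = m →
        ∃ ρ : Representation k G (Fin n → k),
          ρ g = w • LinearMap.id ∧
          (Nat.card G : k) ≠ 0 ∧
          polyInvariants ρ = veronese k n m ∧
          ((n = 3 ∧ 3 ≤ m ∨ 4 ≤ n ∧ m ≠ 1) →
            tauG ρ = Nat.card G ∧
            (∃ i : ℕ, (((i + 1) * tauG ρ : ℕ) : EReal) < veroneseSyzygyEnd k n m i) ∧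
            ¬ DerksenInequalities ρ) := by
  obtain ⟨c, hc⟩ := veroneseSyzygyEnd_eq k n m hm
  refine ⟨⟨isMinimalGenerators_veroneseGen hm, c, ?_⟩, ?_⟩
  · rw [hc, ceil_div_mul_eq n m hm, ← EReal.coe_sub]
    rw [Nat.cast_add, Nat.cast_mul c m, add_sub_cancel_right]
  · intro w hw G _ g hg hG
    have hg' : ∀ x, x ∈ Subgroup.zpowers g := fun x => hg ▸ Subgroup.mem_top x
    have hunit : IsUnit w := hw.isUnit hm.ne'
    -- The order of `w` divides that of `g`, so `g ↦ w` extends to a character.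
    have hord : orderOf hunit.unit ∣ orderOf g := by
      rw [orderOf_eq_card_of_forall_mem_zpowers hg', hG]
      exact orderOf_dvd_of_pow_eq_one (Units.ext (by simpa using hw.pow_eq_one))
    let χ : G →* kˣ := monoidHomOfForallMemZpowers hg' hord
    have hχ : (χ g : k) = w := by
      simp [χ, monoidHomOfForallMemZpowers_apply_gen]
    have hρ := polyInvariants_scalarRepresentation (n := n) hw hχ hg
    refine ⟨scalarRepresentation n χ, ?_, ?_, hρ, fun h => ?_⟩
    · rw [scalarRepresentation_apply, hχ]
    · have : NeZero m := ⟨hm.ne'⟩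
      rw [hG]
      -- A field containing a primitive `m`th root of unity has characteristic not dividing `m`.
      exact hw.neZero'.out
    · have htau : tauG (scalarRepresentation n χ) = m :=
        tauG_eq_of_polyInvariants_eq hm (by lia) hρ
      have hlt : (((c + 1) * tauG (scalarRepresentation n χ) : ℕ) : EReal) <
          veroneseSyzygyEnd k n m c := by
        rw [htau, hc, ← EReal.coe_natCast, EReal.coe_lt_coe_iff, Nat.cast_lt]
        have := Nat.mul_le_mul_right m (two_le_mul_sub_one_div h hm)
        rw [add_mul, one_mul, add_comm]
        lia
      exact ⟨htau.trans hG.symm, ⟨c, hlt⟩, not_derksenInequalities_of_lt hm hρ hlt⟩
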